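/- Notation. Let $\mu$ be Lebesgue measure and $\{y\}=y-\lfloor y\rfloor$. For a real sequence $(x_j)_{j\ge 0}$ in $[0,1)$ put $$D_N((x_j))=\sup_{0\le u<v\le 1}\left|\frac{\#\{0\le j<N: u\le x_j<v\}}{N}-(v-u)\right|,$$ $$F(M,N,\alpha_1,\alpha_2,(x_j))=\bigl|\#\{M\le j<M+N:\alpha_1\le x_j<\alpha_2\}-(\alpha_2-\alpha_1)N\bigr|.$$ For real $\delta>0$ and an integer $b\ge 2$ let $C_b=166+\frac{664}{\sqrt b-1}$, $\tilde C_b=\frac12+\frac{2}{\sqrt b-1}$, $\phi(N)=2(1+2\delta)\tilde C_b\,(N\log\log N)^{1/2}$ and $T(N)=\lfloor \log N/\log 4\rfloor+1$. For integers $1\le h\le t$ let $k(t,h)=h+1$ if $h<t$ and $k(t,t)=t$. For $n\ge 1$ let $G_{b,n}$ be the set of all $x\in(0,1)$ for which there are integers $1\le h\le T(2^n)$ and $0\le a<2^{k}$, where $k=k(T(2^n),h)$, with $$F(0,2^n,a2^{-k},(a+1)2^{-k},(\{b^jx\})_{j\ge0})\ge 2^{-h/8}\phi(2^n).$$ Let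 $H_{b,n}$ be the set of all $x\in(0,1)$ for which there are integers $n/2\le\ell\le n$, $1\le m\le 2^{n-\ell}$, $1\le h\le T(2^{\ell-1})$ and $0\le a<2^{k}$, where $k=k(T(2^{\ell-1}),h)$, with $$F(2^n+m2^\ell,2^{\ell-1},a2^{-k},(a+1)2^{-k},(\{b^jx\})_{j\ge0})\ge 2^{-h/8}\,2^{(\ell-n-3)/6}\phi(2^n).$$ Lemma. Let $\eta,\delta>0$ be real. For every integer $n>e^{6/(\delta\log 2)}$ and every integer $b\ge2$, $$\mu(G_{b,n})\le n^{-1-4\delta},\qquad \mu(H_{b,n})\le 2n^{-1-3\delta}.$$ Moreover there is $n_0=n_0(\eta,\delta)$, not depending on $b$, such that for every integer $b\ge 2$ $$\mu\Bigl(\bigcup_{n\ge n_0}(G_{b,n}\cup H_{b,n})\Bigr)<\eta,$$ and every real $x\in(0,1)$ outside $\bigcup_{n\ge n_0}(G_{b,n}\cup H_{b,n})$ satisfies $$\limsup_{N\to\infty}\frac{D_N((\{b^jx\})_{j\ge0})\sqrt N}{\sqrt{\log\log N}}<(1+4\delta)\,C_b .$$ -/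

import Mathlib

namespace PhilippLIL

noncomputable section

/-- The sequence of fractional parts `({b ^ j * x})`, indexed by `j ≥ 0`. -/
def orbit (b : ℕ) (x : ℝ) (j : ℕ) : ℝ := Int.fract ((b : ℝ) ^ j * x)

/-- The number of indices `M ≤ j < M + N` with `u ≤ y j < v`. -/
def visits (M N : ℕ) (u v : ℝ) (y : ℕ → ℝ) : ℕ :=
  ((Finset.Ico M (M + N)).filter (fun j => u ≤ y j ∧ y j < v)).card

/-- `F (M, N, u, v, y)`, the absolute value of `visits - (v - u) * N`. -/
def F (M N : ℕ) (u v : ℝ) (y : ℕ → ℝ) : ℝ :=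
  |(visits M N u v y : ℝ) - (v - u) * (N : ℝ)|

/-- The discrepancy of the first `N` terms `y 0, …, y (N - 1)`. The supremum is over a non-empty
set of reals, bounded by `bddAbove_discrepancy`. -/
def discrepancy (N : ℕ) (y : ℕ → ℝ) : ℝ :=
  sSup {d : ℝ | ∃ u v : ℝ, 0 ≤ u ∧ u < v ∧ v ≤ 1 ∧
    d = |(visits 0 N u v y : ℝ) / (N : ℝ) - (v - u)|}

theorem bddAbove_discrepancy (N : ℕ) (y : ℕ → ℝ) :
    BddAbove {d : ℝ | ∃ u v : ℝ, 0 ≤ u ∧ u < v ∧ v ≤ 1 ∧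
      d = |(visits 0 N u v y : ℝ) / (N : ℝ) - (v - u)|} := by
  refine ⟨1, ?_⟩
  rintro d ⟨u, v, hu, huv, hv, rfl⟩
  have h1 : (visits 0 N u v y : ℝ) ≤ N := by
    have h : visits 0 N u v y ≤ N := by
      unfold visits
      exact (Finset.card_filter_le _ _).trans (by simp)
    exact_mod_cast h
  have h2 : (visits 0 N u v y : ℝ) / (N : ℝ) ≤ 1 := div_le_one_of_le₀ h1 (Nat.cast_nonneg N)
  have h3 : 0 ≤ (visits 0 N u v y : ℝ) / (N : ℝ) := by positivity
  rw [abs_le]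
  constructor <;> linarith

/-- The constant `1/2 + 2/(√b - 1)`. -/
def Ctilde (b : ℕ) : ℝ := 1 / 2 + 2 / (Real.sqrt b - 1)

/-- Philipp's constant `166 + 664/(√b - 1)`. -/
def philippConst (b : ℕ) : ℝ := 166 + 664 / (Real.sqrt b - 1)

/-- `φ(N) = 2 (1 + 2δ) (1/2 + 2/(√b - 1)) (N log log N)^{1/2}`. -/
def phi (δ : ℝ) (b N : ℕ) : ℝ :=
  2 * (1 + 2 * δ) * Ctilde b * Real.sqrt ((N : ℝ) * Real.log (Real.log (N : ℝ)))

/-- `T(N) = ⌊log N / log 4⌋ + 1`. -/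
def T (N : ℕ) : ℕ := ⌊Real.log (N : ℝ) / Real.log 4⌋₊ + 1

/-- The level `k` of the dyadic intervals `[a 2^{-k}, (a+1) 2^{-k})` attached to the index
`1 ≤ h ≤ t`: it is `h + 1` for `h < t`, and it is `t` for `h = t`. -/
def level (t h : ℕ) : ℕ := if h < t then h + 1 else t

/-- The set `G(b, n, a, h)`. -/
def GSet (δ : ℝ) (b n a h : ℕ) : Set ℝ :=
  {x | x ∈ Set.Ioo (0 : ℝ) 1 ∧
    (2 : ℝ) ^ (-(h : ℝ) / 8) * phi δ b (2 ^ n) ≤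
      F 0 (2 ^ n) ((a : ℝ) / 2 ^ level (T (2 ^ n)) h) (((a : ℝ) + 1) / 2 ^ level (T (2 ^ n)) h)
        (orbit b x)}

/-- The set `H(b, n, a, h, ℓ, m)`. -/
def HSet (δ : ℝ) (b n a h l m : ℕ) : Set ℝ :=
  {x | x ∈ Set.Ioo (0 : ℝ) 1 ∧
    (2 : ℝ) ^ (-(h : ℝ) / 8) * (2 : ℝ) ^ (((l : ℝ) - (n : ℝ) - 3) / 6) * phi δ b (2 ^ n) ≤
      F (2 ^ n + m * 2 ^ l) (2 ^ (l - 1))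
        ((a : ℝ) / 2 ^ level (T (2 ^ (l - 1))) h)
        (((a : ℝ) + 1) / 2 ^ level (T (2 ^ (l - 1))) h)
        (orbit b x)}

/-- `G_{b,n}`: the union of the sets `G(b, n, a, h)` over `1 ≤ h ≤ T(2^n)` and over all dyadic
intervals in `[0, 1)` of the level attached to `h`. -/
def GUnion (δ : ℝ) (b n : ℕ) : Set ℝ :=
  {x | ∃ h a : ℕ, 1 ≤ h ∧ h ≤ T (2 ^ n) ∧ a < 2 ^ level (T (2 ^ n)) h ∧ x ∈ GSet δ b n a h}

/-- `H_{b,n}`: the union of the sets `H(b, n, a, h, ℓ, m)` over the integers `n/2 ≤ ℓ ≤ n` with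
`ℓ ≥ 1`, over `1 ≤ m ≤ 2^{n-ℓ}`, over `1 ≤ h ≤ T(2^{ℓ-1})` and over all dyadic intervals in
`[0, 1)` of the level attached to `h`. -/
def HUnion (δ : ℝ) (b n : ℕ) : Set ℝ :=
  {x | ∃ l m h a : ℕ, 1 ≤ l ∧ (n : ℝ) / 2 ≤ (l : ℝ) ∧ l ≤ n ∧ 1 ≤ m ∧ m ≤ 2 ^ (n - l) ∧
    1 ≤ h ∧ h ≤ T (2 ^ (l - 1)) ∧ a < 2 ^ level (T (2 ^ (l - 1))) h ∧
    x ∈ HSet δ b n a h l m}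

/-- The exceptional set, the union of `G_{b,n} ∪ H_{b,n}` over `n ≥ n₀`. -/
def exceptional (δ : ℝ) (b n₀ : ℕ) : Set ℝ :=
  ⋃ n ∈ Set.Ici n₀, (GUnion δ b n ∪ HUnion δ b n)

end

end PhilippLIL

namespace PhilippLIL

open MeasureTheory Set Filter
open scoped ENNReal

/-! Multiplication by `b` modulo one preserves Lebesgue measure, and its transfer operator `avg`
averages over the `b` preimages. Applied `k` times to the centred indicator of `[u, v)`, it gives
`dev b u v k`, which is at most `b ^ (-k)` in absolute value because the preimages of order `k` are
equally spaced. Adding the truncated coboundary `corr` turns the centred indicator into something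
close to a reversed martingale difference. The exponential moments of visit counts are thus
controlled one step at a time, with only a boundary term `1 / (b - 1)` left over.

Two one-step estimates are used. Hoeffding's lemma needs only the oscillation `b / (b - 1)`, and
suffices for coarse intervals and for small `n`. For short intervals the small variance must be
exploited, as in Bernstein's inequality; this requires base at least `1 / (v - u)`. The base is
therefore raised to `b ^ L` by splitting the indices modulo `L` and recombining by Hölder. The loss
of a factor `L`, about `h * log 2 / log b`, is absorbed by `Ctilde b` and by the growth of `2 ^
(3h/4)`. Chernoff's bound then gives `volume_threshold_le_F_le`, with a saving `4 ^ (-i) * 2 ^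
(-2h-1)` that pays for the union over intervals and over starting points. The resulting bounds are
summable in `n` and free of `b`, so one `n₀` serves all bases.

Outside the exceptional set the argument is deterministic. Chaining through dyadic intervals while
never using two consecutive levels bounds `F` over one block for all intervals, at the cost of a
constant `12.42` (`F_le_of_notMem_blockSet`). Binary expansion of `N` then sums the blocks in a
geometric series (`F_initial_le`), giving `160 * phi` in total. The slack between `160` and `166`
absorbs the discretisation errors, and that between `2δ` and `4δ` makes the limsup inequality
strict. -/

/-! ### The transfer operator of multiplication by `b` modulo one -/

/-- Hermite's identity for the ceiling function. -/
theorem sum_ceil_sub_div {b : ℕ} (hb : 0 < b) (y : ℝ) :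
    ∑ i ∈ Finset.range b, ⌈(y - i) / b⌉ = ⌈y⌉ := by
  have hb' : (0 : ℝ) < b := by exact_mod_cast hb
  -- Passing from `y` to `y + 1` shifts the index by one, so only the terms `i = 0` and `i = b`
  -- matter, and they differ by exactly one. This reduces the identity to `y` in `(-1, 0]`, where
  -- every ceiling vanishes.
  have step : ∀ y : ℝ, ∑ i ∈ Finset.range b, ⌈(y + 1 - i) / b⌉
      = ∑ i ∈ Finset.range b, ⌈(y - i) / b⌉ + 1 := by
    intro y
    have h1 := Finset.sum_range_succ (fun i : ℕ => ⌈(y + 1 - i) / (b : ℝ)⌉) b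
    have h2 := Finset.sum_range_succ' (fun i : ℕ => ⌈(y + 1 - i) / (b : ℝ)⌉) b
    have h3 : ⌈(y + 1 - (b : ℕ)) / (b : ℝ)⌉ = ⌈(y + 1 - (0 : ℕ)) / (b : ℝ)⌉ - 1 := by
      rw [← Int.ceil_sub_one]
      congr 1
      field_simp
      simp
    have h4 : ∀ i : ℕ, (y + 1 - ((i + 1 : ℕ) : ℝ)) / (b : ℝ) = (y - i) / b := by
      intro i; push_cast; ring
    simp only [h4] at h2
    simp only [h3] at h1
    linarith
  have base : ∀ z : ℝ, -1 < z → z ≤ 0 → ∑ i ∈ Finset.range b, ⌈(z - i) / (b : ℝ)⌉ = 0 := by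
    intro z hz hz'
    refine Finset.sum_eq_zero fun i hi => ?_
    have hi' : (i : ℝ) + 1 ≤ b := by exact_mod_cast Finset.mem_range.1 hi
    have hi0 : (0 : ℝ) ≤ i := Nat.cast_nonneg i
    rw [Int.ceil_eq_iff]
    constructor
    · rw [lt_div_iff₀ hb']; push_cast; linarith
    · rw [div_le_iff₀ hb']; push_cast; linarith
  have key : ∀ (m : ℤ) (z : ℝ), -1 < z → z ≤ 0 →
      ∑ i ∈ Finset.range b, ⌈(z + m - i) / (b : ℝ)⌉ = m := by
    intro m z hz hz'
    induction m using Int.induction_on with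
    | zero => simpa using base z hz hz'
    | succ k ih =>
      have := step (z + (k : ℤ))
      push_cast at this ih ⊢
      rw [← add_assoc, this, ih]
    | pred k ih =>
      have := step (z + ((-k - 1 : ℤ) : ℝ))
      push_cast at this ih ⊢
      rw [show z + (-(k : ℝ) - 1) + 1 = z + -(k : ℝ) by ring, ih] at this
      linarith
  have := key ⌈y⌉ (y - ⌈y⌉) (by linarith [Int.ceil_lt_add_one y]) (by linarith [Int.le_ceil y])
  simpa using this

/-- The average of `G` over the `b` preimages of `x` under multiplication by `b` modulo one. -/
noncomputable def avg (b : ℕ) (G : ℝ → ℝ) (x : ℝ) : ℝ :=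
  (∑ i ∈ Finset.range b, G ((x + i) / b)) / b

theorem avg_mono {b : ℕ} {G H : ℝ → ℝ} {x : ℝ}
    (h : ∀ i < b, G ((x + i) / b) ≤ H ((x + i) / b)) : avg b G x ≤ avg b H x := by
  unfold avg
  gcongr with i hi
  exact h i (Finset.mem_range.1 hi)

theorem avg_add (b : ℕ) (G H : ℝ → ℝ) (x : ℝ) :
    avg b (fun y => G y + H y) x = avg b G x + avg b H x := by
  simp [avg, Finset.sum_add_distrib, add_div]

theorem avg_const_mul (b : ℕ) (c : ℝ) (G : ℝ → ℝ) (x : ℝ) :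
    avg b (fun y => c * G y) x = c * avg b G x := by
  simp [avg, ← Finset.mul_sum, mul_div_assoc]

theorem avg_const {b : ℕ} (hb : 0 < b) (c x : ℝ) : avg b (fun _ => c) x = c := by
  have : (b : ℝ) ≠ 0 := by positivity
  simp [avg, this]

theorem avg_finset_sum {ι : Type*} (s : Finset ι) (b : ℕ) (G : ι → ℝ → ℝ) (x : ℝ) :
    avg b (fun y => ∑ k ∈ s, G k y) x = ∑ k ∈ s, avg b (G k) x := by
  simp only [avg, Finset.sum_div]
  rw [Finset.sum_comm]

theorem avg_congr {b : ℕ} {G H : ℝ → ℝ} {x : ℝ}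
    (h : ∀ i < b, G ((x + i) / b) = H ((x + i) / b)) : avg b G x = avg b H x :=
  le_antisymm (avg_mono fun i hi => (h i hi).le) (avg_mono fun i hi => (h i hi).ge)

theorem branch_mem_Ico {b i : ℕ} (hi : i < b) {x : ℝ} (hx : x ∈ Ico (0 : ℝ) 1) :
    (x + i) / b ∈ Ico (0 : ℝ) 1 := by
  have hb : (0 : ℝ) < b := by exact_mod_cast (Nat.zero_le i).trans_lt hi
  have hi' : (i : ℝ) + 1 ≤ b := by exact_mod_cast hi
  have hi0 : (0 : ℝ) ≤ i := Nat.cast_nonneg i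
  constructor
  · exact div_nonneg (by linarith [hx.1]) hb.le
  · rw [div_lt_one hb]; linarith [hx.2]

theorem fract_mul_branch {b i : ℕ} (hi : i < b) {x : ℝ} (hx : x ∈ Ico (0 : ℝ) 1) :
    Int.fract (b * ((x + i) / b)) = x := by
  have hb : (b : ℝ) ≠ 0 := by
    have : 0 < b := (Nat.zero_le i).trans_lt hi
    positivity
  rw [mul_div_cancel₀ _ hb, Int.fract_add_natCast, Int.fract_eq_self]
  exact hx

theorem setLIntegral_Ico_branch {b : ℕ} (hb : 0 < b) (F : ℝ → ℝ≥0∞) (i : ℕ) :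
    ∫⁻ x in Ico ((i : ℝ) / b) (((i : ℝ) + 1) / b), F x
      = ∫⁻ x in Ico (0 : ℝ) 1, ENNReal.ofReal (1 / b) * F ((x + i) / b) := by
  have hb' : (0 : ℝ) < b := by exact_mod_cast hb
  have him : (fun x : ℝ => (x + i) / b) '' Ico (0 : ℝ) 1
      = Ico ((i : ℝ) / b) (((i : ℝ) + 1) / b) := by
    ext y
    simp only [mem_image, mem_Ico]
    constructor
    · rintro ⟨x, ⟨h0, h1⟩, rfl⟩
      constructor
      · gcongr; linarith
      · gcongr ?_ / _; linarith
    · rintro ⟨h0, h1⟩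
      rw [div_le_iff₀ hb'] at h0
      rw [lt_div_iff₀ hb'] at h1
      refine ⟨y * b - i, ⟨by linarith, by linarith⟩, ?_⟩
      field_simp
      ring
  rw [← him, lintegral_image_eq_lintegral_abs_deriv_mul (f' := fun _ => 1 / (b : ℝ)) measurableSet_Ico]
  · simp only [abs_of_pos (one_div_pos.2 hb')]
  · intro x _
    exact (((hasDerivAt_id x).add_const (i : ℝ)).div_const (b : ℝ)).hasDerivWithinAt
  · intro x _ y _ h
    simpa [hb'.ne'] using h

theorem setLIntegral_Ico_eq_sum {b : ℕ} (hb : 0 < b) (F : ℝ → ℝ≥0∞) :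
    ∫⁻ x in Ico (0 : ℝ) 1, F x
      = ∑ i ∈ Finset.range b, ∫⁻ x in Ico (0 : ℝ) 1, ENNReal.ofReal (1 / b) * F ((x + i) / b) := by
  have hb' : (0 : ℝ) < b := by exact_mod_cast hb
  have key : ∀ m : ℕ, ∫⁻ x in Ico (0 : ℝ) ((m : ℝ) / b), F x
      = ∑ i ∈ Finset.range m,
        ∫⁻ x in Ico (0 : ℝ) 1, ENNReal.ofReal (1 / b) * F ((x + i) / b) := by
    intro m
    induction m with
    | zero => simp
    | succ m ih =>
      rw [Finset.sum_range_succ, ← ih, ← setLIntegral_Ico_branch hb,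
        ← lintegral_union measurableSet_Ico]
      · rw [Ico_union_Ico_eq_Ico (by positivity) (by gcongr; linarith)]
        push_cast
        rfl
      · exact Ico_disjoint_Ico_same
  have := key b
  rwa [div_self hb'.ne'] at this

theorem lintegral_ofReal_eq_avg {b : ℕ} (hb : 0 < b) {G : ℝ → ℝ} (hG : Measurable G)
    (h0 : ∀ x, 0 ≤ G x) :
    ∫⁻ x in Ico (0 : ℝ) 1, ENNReal.ofReal (G x)
      = ∫⁻ x in Ico (0 : ℝ) 1, ENNReal.ofReal (avg b G x) := by
  rw [setLIntegral_Ico_eq_sum hb, ← lintegral_finsetSum]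
  · refine lintegral_congr fun x => ?_
    rw [avg, Finset.sum_div,
      ENNReal.ofReal_sum_of_nonneg fun i _ => div_nonneg (h0 _) (by positivity)]
    refine Finset.sum_congr rfl fun i _ => ?_
    rw [← ENNReal.ofReal_mul (by positivity), one_div_mul_eq_div]
  · intro i _
    exact ((hG.comp ((measurable_id.add_const _).div_const _)).ennreal_ofReal).const_mul _

theorem lintegral_comp_fract_mul {b : ℕ} (hb : 0 < b) {G : ℝ → ℝ} (hG : Measurable G)
    (h0 : ∀ x, 0 ≤ G x) :
    ∫⁻ x in Ico (0 : ℝ) 1, ENNReal.ofReal (G (Int.fract (b * x)))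
      = ∫⁻ x in Ico (0 : ℝ) 1, ENNReal.ofReal (G x) := by
  rw [lintegral_ofReal_eq_avg hb (G := fun x => G (Int.fract (b * x)))
    (hG.comp (measurable_fract.comp (measurable_id.const_mul _))) (fun x => h0 _)]
  refine setLIntegral_congr_fun measurableSet_Ico fun x hx => ?_
  congr 1
  rw [← avg_const hb (G x) x]
  exact avg_congr fun i hi => by rw [fract_mul_branch hi hx]

/-! ### Iterates of the centred indicator and the coboundary correction -/

/-- The deviation from `v - u` of the proportion of the preimages of `x` of order `k` which lie in
`[u, v)`. -/
noncomputable def dev (b : ℕ) (u v : ℝ) (k : ℕ) (x : ℝ) : ℝ :=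
  ((⌈v * b ^ k - x⌉ : ℝ) - ⌈u * b ^ k - x⌉) / b ^ k - (v - u)

theorem measurable_dev (b : ℕ) (u v : ℝ) (k : ℕ) : Measurable (dev b u v k) := by
  have h : ∀ c : ℝ, Measurable fun x : ℝ => ((⌈c - x⌉ : ℤ) : ℝ) := fun c =>
    measurable_from_top.comp (Int.measurable_ceil.comp (measurable_const.sub measurable_id))
  exact (((h _).sub (h _)).div_const _).sub_const _

theorem dev_zero {u v : ℝ} (hu : 0 ≤ u) (hv : v ≤ 1) (huv : u ≤ v) (b : ℕ) {x : ℝ}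
    (hx : x ∈ Ico (0 : ℝ) 1) : dev b u v 0 x = (if u ≤ x ∧ x < v then 1 else 0) - (v - u) := by
  have hc : ∀ w : ℝ, 0 ≤ w → w ≤ 1 → ⌈w - x⌉ = if x < w then 1 else 0 := by
    intro w h0 h1
    split_ifs with h
    · rw [Int.ceil_eq_iff]; push_cast; constructor <;> linarith [hx.1]
    · rw [Int.ceil_eq_iff]; push_cast; constructor <;> linarith [hx.2]
  rw [dev]
  simp only [pow_zero, mul_one, div_one]
  rw [hc u hu (huv.trans hv), hc v (hu.trans huv) hv]
  congr 1
  by_cases h1 : x < u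
  · have h2 : x < v := h1.trans_le huv
    simp [h1, h2]
  · simp [h1, not_lt.1 h1]

/-- Hermite's identity, applied to each endpoint: the preimages of order `k` of the `b` preimages of
`x` are the preimages of order `k + 1` of `x`. -/
theorem avg_dev {b : ℕ} (hb : 0 < b) (u v : ℝ) (k : ℕ) (x : ℝ) :
    avg b (dev b u v k) x = dev b u v (k + 1) x := by
  have hb' : (b : ℝ) ≠ 0 := by positivity
  have hc : ∀ w : ℝ, ∑ i ∈ Finset.range b, ((⌈w * b ^ k - (x + i) / b⌉ : ℤ) : ℝ)
      = ((⌈w * b ^ (k + 1) - x⌉ : ℤ) : ℝ) := by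
    intro w
    rw [← sum_ceil_sub_div hb]
    push_cast
    refine Finset.sum_congr rfl fun i _ => ?_
    congr 2
    field_simp
    ring
  simp only [avg, dev, Finset.sum_sub_distrib, ← Finset.sum_div, hc]
  simp only [Finset.sum_const, Finset.card_range, nsmul_eq_mul]
  field_simp
  ring

theorem abs_dev_le {b : ℕ} (hb : 0 < b) (u v : ℝ) (k : ℕ) (x : ℝ) :
    |dev b u v k x| ≤ 1 / (b : ℝ) ^ k := by
  have hb' : (0 : ℝ) < (b : ℝ) ^ k := by positivity
  have h : dev b u v k x
      = (((⌈v * b ^ k - x⌉ : ℝ) - ⌈u * b ^ k - x⌉) - (v - u) * b ^ k) / b ^ k := by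
    rw [dev]; field_simp
  rw [h, abs_div, abs_of_pos hb']
  gcongr
  have h1 := Int.le_ceil (v * b ^ k - x)
  have h2 := Int.ceil_lt_add_one (v * b ^ k - x)
  have h3 := Int.le_ceil (u * b ^ k - x)
  have h4 := Int.ceil_lt_add_one (u * b ^ k - x)
  rw [abs_le]; constructor <;> linarith

/-- Twice as good as the triangle inequality: the difference of the two counts is an integer
strictly less than `2`, hence at most `1`. This keeps the oscillation in Hoeffding's lemma down to
`b / (b - 1)`. -/
theorem dev_sub_dev_le {b : ℕ} (hb : 0 < b) (u v : ℝ) (k : ℕ) (x y : ℝ) :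
    dev b u v k x - dev b u v k y ≤ 1 / (b : ℝ) ^ k := by
  have hb' : (0 : ℝ) < (b : ℝ) ^ k := by positivity
  have h : dev b u v k x - dev b u v k y
      = (((⌈v * b ^ k - x⌉ - ⌈u * b ^ k - x⌉) - (⌈v * b ^ k - y⌉ - ⌈u * b ^ k - y⌉) : ℤ) : ℝ)
        / b ^ k := by
    rw [dev, dev]; push_cast; ring
  rw [h]
  gcongr
  have h1 := Int.le_ceil (v * b ^ k - x)
  have h2 := Int.ceil_lt_add_one (v * b ^ k - x)
  have h3 := Int.le_ceil (u * b ^ k - x)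
  have h4 := Int.ceil_lt_add_one (u * b ^ k - x)
  have h5 := Int.le_ceil (v * b ^ k - y)
  have h6 := Int.ceil_lt_add_one (v * b ^ k - y)
  have h7 := Int.le_ceil (u * b ^ k - y)
  have h8 := Int.ceil_lt_add_one (u * b ^ k - y)
  have : (((⌈v * b ^ k - x⌉ - ⌈u * b ^ k - x⌉) - (⌈v * b ^ k - y⌉ - ⌈u * b ^ k - y⌉) : ℤ) : ℝ)
      < (2 : ℤ) := by push_cast; linarith
  have h9 := Int.cast_lt.1 this
  replace h9 := Int.lt_add_one_iff.1 (show _ < (1 : ℤ) + 1 from h9)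
  calc _ ≤ ((1 : ℤ) : ℝ) := Int.cast_le.2 h9
    _ = 1 := Int.cast_one

/-- The truncated coboundary correction `∑_{1 ≤ k ≤ K} dev b u v k`. -/
noncomputable def corr (b : ℕ) (u v : ℝ) (K : ℕ) (x : ℝ) : ℝ :=
  ∑ k ∈ Finset.range K, dev b u v (k + 1) x

theorem measurable_corr (b : ℕ) (u v : ℝ) (K : ℕ) : Measurable (corr b u v K) :=
  Finset.measurable_fun_sum _ fun k _ => measurable_dev b u v (k + 1)

/-- The transfer operator only shifts the summation index. Letting the truncation grow from `K` to
`K + 1` makes the identity exact without an infinite series. -/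
theorem avg_dev_add_corr {b : ℕ} (hb : 0 < b) (u v : ℝ) (K : ℕ) (x : ℝ) :
    avg b (fun y => dev b u v 0 y + corr b u v K y) x = corr b u v (K + 1) x := by
  simp only [corr]
  rw [avg_add, avg_finset_sum, Finset.sum_range_succ' _ K, avg_dev hb, add_comm]
  simp only [avg_dev hb]

theorem sum_one_div_pow_le {b : ℕ} (hb : 2 ≤ b) (K : ℕ) :
    ∑ k ∈ Finset.range K, 1 / (b : ℝ) ^ (k + 1) ≤ 1 / ((b : ℝ) - 1) := by
  have hb' : (2 : ℝ) ≤ b := by exact_mod_cast hb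
  have hb1 : (b : ℝ) - 1 ≠ 0 := by linarith
  have hb0 : (b : ℝ) ≠ 0 := by linarith
  have h : ∀ K : ℕ, ∑ k ∈ Finset.range K, 1 / (b : ℝ) ^ (k + 1)
      = 1 / ((b : ℝ) - 1) - 1 / (b : ℝ) ^ K / ((b : ℝ) - 1) := by
    intro K
    induction K with
    | zero => simp
    | succ K ih => rw [Finset.sum_range_succ, ih]; field_simp; ring
  rw [h]
  have : (0 : ℝ) ≤ 1 / (b : ℝ) ^ K / ((b : ℝ) - 1) := by
    apply div_nonneg (by positivity); linarith
  linarith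

theorem abs_corr_le {b : ℕ} (hb : 2 ≤ b) (u v : ℝ) (K : ℕ) (x : ℝ) :
    |corr b u v K x| ≤ 1 / ((b : ℝ) - 1) :=
  ((Finset.abs_sum_le_sum_abs _ _).trans
    (Finset.sum_le_sum fun _ _ => abs_dev_le (by lia) u v _ x)).trans (sum_one_div_pow_le hb K)

theorem dev_add_corr_sub_le {b : ℕ} (hb : 2 ≤ b) (u v : ℝ) (K : ℕ) (x y : ℝ) :
    (dev b u v 0 x + corr b u v K x) - (dev b u v 0 y + corr b u v K y)
      ≤ (b : ℝ) / ((b : ℝ) - 1) := by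
  have hb' : (2 : ℝ) ≤ b := by exact_mod_cast hb
  have h0 := dev_sub_dev_le (b := b) (by lia) u v 0 x y
  have h1 : corr b u v K x - corr b u v K y ≤ 1 / ((b : ℝ) - 1) := by
    rw [corr, corr, ← Finset.sum_sub_distrib]
    exact (Finset.sum_le_sum fun k _ => dev_sub_dev_le (by lia) u v (k + 1) x y).trans
      (sum_one_div_pow_le hb K)
  have h2 : (b : ℝ) / ((b : ℝ) - 1) = 1 + 1 / ((b : ℝ) - 1) := by
    have hb1 : (b : ℝ) - 1 ≠ 0 := by linarith
    field_simp
    ring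
  rw [h2]
  simp only [pow_zero, div_one] at h0
  linarith

/-! ### Exponential moments of a single step -/

/-- Hoeffding's lemma for a finite average. -/
theorem avg_exp_le_of_sub_le {b : ℕ} (hb : 0 < b) (G : ℝ → ℝ) {c : ℝ}
    (hG : ∀ y z, G y - G z ≤ c) (t x : ℝ) :
    avg b (fun y => Real.exp (t * G y)) x ≤ Real.exp (t ^ 2 * c ^ 2 / 8 + t * avg b G x) := by
  have hne : Nonempty (Fin b) := ⟨⟨0, hb⟩⟩
  set X : Fin b → ℝ := fun i => G ((x + i) / b) with hX
  -- The average over branches is an expectation for the uniform law on `Fin b`, to which the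
  -- sub-Gaussian bound for bounded variables applies.
  let μ : Measure (Fin b) := (PMF.uniformOfFintype (Fin b)).toMeasure
  have hint : ∀ H : ℝ → ℝ, ∫ i : Fin b, H ((x + i) / b) ∂μ = avg b H x := by
    intro H
    rw [PMF.integral_eq_sum]
    simp only [PMF.uniformOfFintype_apply, Fintype.card_fin, ENNReal.toReal_inv,
      ENNReal.toReal_natCast, smul_eq_mul, ← Finset.mul_sum]
    rw [Fin.sum_univ_eq_sum_range (fun i : ℕ => H ((x + i) / b)) b, avg, div_eq_inv_mul]
  obtain ⟨i₀, hi₀⟩ := Finite.exists_min X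
  have hsub := ProbabilityTheory.hasSubgaussianMGF_of_mem_Icc (μ := μ) (X := X) (a := X i₀)
    (b := X i₀ + c) (measurable_of_finite X).aemeasurable
    (ae_of_all _ fun i => ⟨hi₀ i, by linarith [hG ((x + i) / b) ((x + i₀) / b)]⟩)
  have h := hsub.mgf_le t
  have hmean : ∫ i, X i ∂μ = avg b G x := hint G
  rw [ProbabilityTheory.mgf] at h
  simp only [hmean] at h
  have h2 : ∀ i : Fin b, Real.exp (t * (X i - avg b G x))
      = Real.exp (-(t * avg b G x)) * (fun y => Real.exp (t * G y)) ((x + i) / b) := by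
    intro i
    rw [← Real.exp_add]
    congr 1
    simp only [hX]
    ring
  simp only [h2] at h
  rw [integral_const_mul, hint fun y => Real.exp (t * G y)] at h
  rw [Real.exp_add, ← div_le_iff₀ (Real.exp_pos _), div_eq_inv_mul, ← Real.exp_neg]
  refine h.trans (Real.exp_le_exp.2 (le_of_eq ?_))
  simp only [add_sub_cancel_left, NNReal.coe_pow, NNReal.coe_div, coe_nnnorm, Real.norm_eq_abs,
    NNReal.coe_ofNat, div_pow, sq_abs]
  ring

theorem exp_le_one_add_add_sq {y : ℝ} (hy : |y| ≤ 1) :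
    Real.exp y ≤ 1 + y + 3 / 4 * y ^ 2 := by
  have h := Real.exp_bound hy (n := 3) (by norm_num)
  simp [Finset.sum_range_succ, Nat.factorial] at h
  have h3 : |y| ^ 3 ≤ y ^ 2 := by
    rw [← sq_abs y]
    nlinarith [abs_nonneg y, sq_nonneg |y|]
  have := (abs_le.1 h).2
  nlinarith

/-- An exponential moment bound of Bernstein type for a finite average. -/
theorem avg_exp_le_of_avg_sq_le {b : ℕ} (hb : 0 < b) (G : ℝ → ℝ) {c V t x d : ℝ}
    (hG : ∀ y z, G y - G z ≤ c) (htc : |t| * c ≤ 1)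
    (hV : avg b (fun y => (G y - d) ^ 2) x ≤ V) :
    avg b (fun y => Real.exp (t * G y)) x ≤ Real.exp (3 / 4 * t ^ 2 * V + t * avg b G x) := by
  set m := avg b G x with hm
  have hmle : ∀ i < b, |t * (G ((x + i) / b) - m)| ≤ 1 := by
    intro i _
    rw [abs_mul]
    refine (mul_le_mul_of_nonneg_left ?_ (abs_nonneg t)).trans htc
    have h1 : m ≤ G ((x + i) / b) + c := by
      rw [hm, ← avg_const hb (G ((x + i) / b) + c) x]
      exact avg_mono fun j _ => by linarith [hG ((x + j) / b) ((x + i) / b)]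
    have h2 : G ((x + i) / b) - c ≤ m := by
      rw [hm, ← avg_const hb (G ((x + i) / b) - c) x]
      exact avg_mono fun j _ => by linarith [hG ((x + i) / b) ((x + j) / b)]
    rw [abs_le]; constructor <;> linarith
  -- The second moment about the mean is the least one, so any convenient centre `d` may be used to
  -- bound the variance.
  have hvar : avg b (fun y => (G y - m) ^ 2) x ≤ V := by
    refine le_trans ?_ hV
    have e1 : avg b (fun y => (G y - d) ^ 2) x
        = avg b (fun y => (G y - m) ^ 2 + ((2 * (m - d)) * G y + (d ^ 2 - m ^ 2))) x :=
      avg_congr fun i _ => by ring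
    rw [e1, avg_add, avg_add, avg_const_mul, avg_const hb, ← hm]
    nlinarith [sq_nonneg (m - d)]
  have h1 : avg b (fun y => Real.exp (t * (G y - m))) x ≤ 1 + 3 / 4 * t ^ 2 * V := by
    calc avg b (fun y => Real.exp (t * (G y - m))) x
        ≤ avg b (fun y => (1 - t * m) + (t * G y + 3 / 4 * t ^ 2 * (G y - m) ^ 2)) x :=
          avg_mono fun i hi => by
            have := exp_le_one_add_add_sq (hmle i hi)
            nlinarith
      _ = 1 + 3 / 4 * t ^ 2 * avg b (fun y => (G y - m) ^ 2) x := by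
          rw [avg_add, avg_add, avg_const_mul, avg_const_mul, avg_const hb, ← hm]; ring
      _ ≤ _ := by gcongr
  have h2 : avg b (fun y => Real.exp (t * G y)) x
      = Real.exp (t * m) * avg b (fun y => Real.exp (t * (G y - m))) x := by
    rw [← avg_const_mul]
    refine avg_congr fun i _ => ?_
    rw [← Real.exp_add]
    congr 1
    ring
  rw [h2, add_comm (3 / 4 * t ^ 2 * V), Real.exp_add]
  gcongr
  refine h1.trans ?_
  linarith [Real.add_one_le_exp (3 / 4 * t ^ 2 * V)]

/-! ### Exponential moments along an orbit -/

/-- The centred number of visits of `x, bx, …, b ^ (M - 1) x` modulo one to `[u, v)`. -/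
noncomputable def devSum (b : ℕ) (u v : ℝ) (M : ℕ) (x : ℝ) : ℝ :=
  ∑ j ∈ Finset.range M, dev b u v 0 (orbit b x j)

theorem measurable_orbit (b j : ℕ) : Measurable fun x => orbit b x j :=
  measurable_fract.comp (measurable_id.const_mul _)

theorem measurable_devSum (b : ℕ) (u v : ℝ) (M : ℕ) : Measurable (devSum b u v M) :=
  Finset.measurable_fun_sum _ fun j _ => (measurable_dev b u v 0).comp (measurable_orbit b j)

theorem orbit_mem_Ico (b : ℕ) (x : ℝ) (j : ℕ) : orbit b x j ∈ Ico (0 : ℝ) 1 :=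
  ⟨Int.fract_nonneg _, Int.fract_lt_one _⟩

theorem fract_natCast_mul_fract (c : ℕ) (y : ℝ) :
    Int.fract ((c : ℝ) * Int.fract y) = Int.fract (c * y) := by
  rw [Int.fract_eq_fract]
  refine ⟨-(c * ⌊y⌋), ?_⟩
  rw [Int.fract]
  push_cast
  ring

theorem orbit_orbit (b : ℕ) (x : ℝ) (r q L : ℕ) :
    orbit (b ^ L) (orbit b x r) q = orbit b x (r + L * q) := by
  have := fract_natCast_mul_fract ((b ^ L) ^ q) ((b : ℝ) ^ r * x)
  simp only [orbit]
  push_cast at this ⊢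
  rw [this]
  congr 1
  rw [pow_add, pow_mul]
  ring

theorem devSum_succ (b : ℕ) (u v : ℝ) (M : ℕ) {x : ℝ} (hx : x ∈ Ico (0 : ℝ) 1) :
    devSum b u v (M + 1) x = dev b u v 0 x + devSum b u v M (Int.fract (b * x)) := by
  rw [devSum, Finset.sum_range_succ', add_comm]
  congr 1
  · congr 1
    simpa [orbit] using Int.fract_eq_self.2 hx
  · refine Finset.sum_congr rfl fun j _ => ?_
    have := orbit_orbit b x 1 j 1
    simp only [pow_one, one_mul] at this
    rw [add_comm j 1, ← this]
    simp [orbit]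

/-- Peel off the first iterate: the integral is unchanged by `avg`, the later iterates depend only
on the image point and so are constant over its preimages, and the one-step hypothesis replaces the
first term and `corr K` by `ψ` and `corr (K + 1)`. The statement has to be proved for all `K` at
once because `K` moves in the induction. -/
theorem lintegral_exp_devSum_add_corr_le {b : ℕ} (hb : 0 < b) {u v t ψ : ℝ}
    (h : ∀ K, ∀ x ∈ Ico (0 : ℝ) 1,
      avg b (fun y => Real.exp (t * (dev b u v 0 y + corr b u v K y))) x
        ≤ Real.exp (ψ + t * corr b u v (K + 1) x)) (M : ℕ) : ∀ K : ℕ,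
    ∫⁻ x in Ico (0 : ℝ) 1, ENNReal.ofReal (Real.exp (t * (devSum b u v M x + corr b u v K x)))
      ≤ ENNReal.ofReal (Real.exp (M * ψ)) *
        ∫⁻ x in Ico (0 : ℝ) 1, ENNReal.ofReal (Real.exp (t * corr b u v (K + M) x)) := by
  induction M with
  | zero => intro K; simp [devSum]
  | succ M ih =>
    intro K
    have hmeas : ∀ M K, Measurable fun x =>
        Real.exp (t * (devSum b u v M x + corr b u v K x)) := fun M K =>
      (((measurable_devSum b u v M).add (measurable_corr b u v K)).const_mul t).exp
    rw [lintegral_ofReal_eq_avg hb (hmeas _ _) fun _ => (Real.exp_pos _).le]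
    calc _ ≤ ∫⁻ x in Ico (0 : ℝ) 1, ENNReal.ofReal (Real.exp ψ) *
          ENNReal.ofReal (Real.exp (t * (devSum b u v M x + corr b u v (K + 1) x))) := by
          refine setLIntegral_mono' measurableSet_Ico fun x hx => ?_
          rw [← ENNReal.ofReal_mul (Real.exp_pos _).le]
          refine ENNReal.ofReal_le_ofReal ?_
          have e1 : avg b (fun y => Real.exp (t * (devSum b u v (M + 1) y + corr b u v K y))) x
              = avg b (fun y => Real.exp (t * devSum b u v M x) *
                Real.exp (t * (dev b u v 0 y + corr b u v K y))) x := by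
            refine avg_congr fun i hi => ?_
            rw [devSum_succ _ _ _ _ (branch_mem_Ico hi hx), fract_mul_branch hi hx, ← Real.exp_add]
            congr 1
            ring
          rw [e1, avg_const_mul]
          refine (mul_le_mul_of_nonneg_left (h K x hx) (Real.exp_pos _).le).trans_eq ?_
          rw [← Real.exp_add, ← Real.exp_add]
          congr 1
          ring
      _ ≤ _ := by
          rw [lintegral_const_mul _ (hmeas _ _).ennreal_ofReal]
          refine (mul_le_mul_right (ih (K + 1)) _).trans_eq ?_
          rw [← mul_assoc, ← ENNReal.ofReal_mul (Real.exp_pos _).le, ← Real.exp_add,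
            show K + 1 + M = K + (M + 1) by ring]
          congr 3
          push_cast
          ring

theorem lintegral_exp_devSum_le {b : ℕ} (hb : 2 ≤ b) {u v t ψ : ℝ}
    (h : ∀ K, ∀ x ∈ Ico (0 : ℝ) 1,
      avg b (fun y => Real.exp (t * (dev b u v 0 y + corr b u v K y))) x
        ≤ Real.exp (ψ + t * corr b u v (K + 1) x)) (M : ℕ) :
    ∫⁻ x in Ico (0 : ℝ) 1, ENNReal.ofReal (Real.exp (t * devSum b u v M x))
      ≤ ENNReal.ofReal (Real.exp (M * ψ + |t| / ((b : ℝ) - 1))) := by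
  have h0 := lintegral_exp_devSum_add_corr_le (by lia) h M 0
  have e0 : ∀ x, corr b u v 0 x = 0 := fun x => by simp [corr]
  simp only [e0, add_zero] at h0
  refine h0.trans ?_
  rw [Real.exp_add, ENNReal.ofReal_mul (Real.exp_pos _).le]
  gcongr
  calc _ ≤ ∫⁻ x in Ico (0 : ℝ) 1, ENNReal.ofReal (Real.exp (|t| / ((b : ℝ) - 1))) := by
        refine lintegral_mono fun x => ENNReal.ofReal_le_ofReal (Real.exp_le_exp.2 ?_)
        refine (le_abs_self _).trans ?_
        rw [abs_mul, div_eq_mul_one_div]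
        gcongr
        exact abs_corr_le hb u v _ x
    _ = _ := by simp

/-- The exponential moment hypothesis of `lintegral_exp_devSum_le`, in the form of Hoeffding. -/
theorem avg_exp_le_hoeffding {b : ℕ} (hb : 2 ≤ b) (u v t : ℝ) (K : ℕ) (x : ℝ) :
    avg b (fun y => Real.exp (t * (dev b u v 0 y + corr b u v K y))) x
      ≤ Real.exp (t ^ 2 * ((b : ℝ) / ((b : ℝ) - 1)) ^ 2 / 8 + t * corr b u v (K + 1) x) := by
  have := avg_exp_le_of_sub_le (b := b) (by lia) (fun y => dev b u v 0 y + corr b u v K y)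
    (fun y z => dev_add_corr_sub_le hb u v K y z) t x
  rwa [avg_dev_add_corr (by lia)] at this

/-- The exponential moment hypothesis of `lintegral_exp_devSum_le`, in the form of Bernstein. -/
theorem avg_exp_le_bernstein {b : ℕ} (hb : 32 ≤ b) {u v t : ℝ} (hu : 0 ≤ u) (hv : v ≤ 1)
    (hp : 1 ≤ (v - u) * b) (ht : |t| ≤ 15 / 16) (K : ℕ) {x : ℝ} (hx : x ∈ Ico (0 : ℝ) 1) :
    avg b (fun y => Real.exp (t * (dev b u v 0 y + corr b u v K y))) x
      ≤ Real.exp (13 / 8 * (v - u) * t ^ 2 + t * corr b u v (K + 1) x) := by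
  have hb' : (32 : ℝ) ≤ b := by exact_mod_cast hb
  have hb1 : (0 : ℝ) < (b : ℝ) - 1 := by linarith
  have hp0 : 0 < v - u := by
    by_contra hneg
    have : (v - u) * b ≤ 0 := mul_nonpos_of_nonpos_of_nonneg (not_lt.1 hneg) (by linarith)
    linarith
  have hinv : 1 / (b : ℝ) ≤ v - u := by rw [div_le_iff₀ (by linarith)]; exact hp
  have hε : 1 / ((b : ℝ) - 1) ≤ 1 / 31 := by
    apply one_div_le_one_div_of_le <;> linarith
  have hε2 : (1 / ((b : ℝ) - 1)) ^ 2 ≤ 1 / 30 * (v - u) := by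
    have h1 : (1 / ((b : ℝ) - 1)) ^ 2 ≤ 1 / 30 * (1 / b) := by
      rw [div_pow, one_pow, div_mul_div_comm, one_mul]
      apply one_div_le_one_div_of_le <;> nlinarith
    nlinarith
  have htc : |t| * ((b : ℝ) / ((b : ℝ) - 1)) ≤ 1 := by
    have : (b : ℝ) / ((b : ℝ) - 1) ≤ 16 / 15 := by
      rw [div_le_iff₀ hb1]; linarith
    nlinarith [abs_nonneg t]
  have hav : avg b (fun y => ((dev b u v 0 y + corr b u v K y) - (-(v - u))) ^ 2) x
      ≤ 13 / 6 * (v - u) := by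
    -- With centre `-(v - u)` the square is `(1_I + c) ^ 2`, where `c` is the correction and `|c| ≤
    -- 1 / 31`: the cross term costs a factor `33 / 31` on the indicator, and `c ^ 2 ≤ (v - u) /
    -- 30`. The indicator averages to at most `(v - u) + 1 / b ≤ 2 (v - u)`, and `66 / 31 + 1 / 30 ≤
    -- 13 / 6`.
    calc _ ≤ avg b (fun y => (33 / 31) * (dev b u v 0 y + (v - u)) + 1 / 30 * (v - u)) x := by
          refine avg_mono fun i hi => ?_
          rw [dev_zero hu hv (by linarith) b (branch_mem_Ico hi hx)]
          have hc := abs_corr_le (b := b) (by lia) u v K ((x + i) / b)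
          have hc2 := sq_le_sq' (by linarith [(abs_le.1 hc).1]) (abs_le.1 hc).2
          have hc3 := (abs_le.1 (hc.trans hε)).2
          set c := corr b u v K ((x + i) / b)
          split_ifs <;> nlinarith
      _ = 33 / 31 * (dev b u v 1 x + (v - u)) + 1 / 30 * (v - u) := by
          rw [avg_add, avg_const (by lia), avg_const_mul, avg_add, avg_const (by lia),
            avg_dev (by lia)]
      _ ≤ _ := by
          have := (abs_le.1 (abs_dev_le (b := b) (by lia) u v 1 x)).2
          rw [pow_one] at this
          linarith
  have := avg_exp_le_of_avg_sq_le (b := b) (by lia) (fun y => dev b u v 0 y + corr b u v K y)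
    (fun y z => dev_add_corr_sub_le (by lia) u v K y z) htc hav
  rw [avg_dev_add_corr (by lia)] at this
  refine this.trans (Real.exp_le_exp.2 (le_of_eq ?_))
  ring

/-! ### Raising the base: residue classes modulo `L` and Hölder's inequality -/

/-- Splitting a sum over `range N` into residue classes modulo `L`. -/
theorem sum_range_eq_sum_residues {A : Type*} [AddCommMonoid A] {L : ℕ} (hL : 0 < L) (N : ℕ)
    (f : ℕ → A) :
    ∑ j ∈ Finset.range N, f j
      = ∑ r ∈ Finset.range L, ∑ q ∈ Finset.range ((N + L - 1 - r) / L), f (r + L * q) := by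
  rw [Finset.sum_sigma']
  have hiff : ∀ r < L, ∀ q, q < (N + L - 1 - r) / L ↔ r + L * q < N := by
    intro r hr q
    rw [Nat.lt_iff_add_one_le, Nat.le_div_iff_mul_le hL, Nat.add_one_mul, mul_comm q L]
    lia
  refine Finset.sum_nbij' (fun j => ⟨j % L, j / L⟩) (fun s => s.1 + L * s.2) ?_ ?_ ?_ ?_ ?_
  · intro j hj
    simp only [Finset.mem_sigma, Finset.mem_range] at hj ⊢
    have := Nat.mod_lt j hL
    exact ⟨this, (hiff _ this _).2 (by rwa [Nat.mod_add_div])⟩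
  · rintro ⟨r, q⟩ h
    simp only [Finset.mem_sigma, Finset.mem_range] at h ⊢
    exact (hiff r h.1 q).1 h.2
  · intro j _
    exact Nat.mod_add_div j L
  · rintro ⟨r, q⟩ h
    simp only [Finset.mem_sigma, Finset.mem_range] at h
    simp [Nat.add_mul_mod_self_left, Nat.mod_eq_of_lt h.1, Nat.add_mul_div_left _ _ hL,
      Nat.div_eq_of_lt h.1]
  · intro j _
    simp only [Nat.mod_add_div]

theorem devSum_eq_sum_devSum {L : ℕ} (hL : 0 < L) (b : ℕ) (u v : ℝ) (N : ℕ) (x : ℝ) :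
    devSum b u v N x
      = ∑ r ∈ Finset.range L, devSum (b ^ L) u v ((N + L - 1 - r) / L) (orbit b x r) := by
  rw [devSum, sum_range_eq_sum_residues hL]
  refine Finset.sum_congr rfl fun r _ => Finset.sum_congr rfl fun q _ => ?_
  rw [orbit_orbit]
  -- At order zero `dev` does not depend on the base, since `b ^ 0 = 1`.
  simp [dev]

theorem lintegral_comp_orbit {b : ℕ} (hb : 0 < b) (r : ℕ) {G : ℝ → ℝ} (hG : Measurable G)
    (h0 : ∀ x, 0 ≤ G x) :
    ∫⁻ x in Ico (0 : ℝ) 1, ENNReal.ofReal (G (orbit b x r))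
      = ∫⁻ x in Ico (0 : ℝ) 1, ENNReal.ofReal (G x) := by
  have := lintegral_comp_fract_mul (b := b ^ r) (by positivity) hG h0
  simpa [orbit] using this

/-- The exponential moments of `devSum`, from those of the sums along the residue classes
modulo `L`, by Hölder's inequality. -/
theorem lintegral_exp_devSum_le_of_pow {b L : ℕ} (hb : 2 ≤ b) (hL : 0 < L) {u v t ψ : ℝ}
    (h : ∀ K, ∀ x ∈ Ico (0 : ℝ) 1,
      avg (b ^ L) (fun y => Real.exp (L * t * (dev (b ^ L) u v 0 y + corr (b ^ L) u v K y))) x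
        ≤ Real.exp (ψ + L * t * corr (b ^ L) u v (K + 1) x)) (N : ℕ) :
    ∫⁻ x in Ico (0 : ℝ) 1, ENNReal.ofReal (Real.exp (t * devSum b u v N x))
      ≤ ENNReal.ofReal (Real.exp (N * ψ / L + L * |t| / ((b : ℝ) ^ L - 1))) := by
  have hL' : (0 : ℝ) < L := by exact_mod_cast hL
  have hB : 2 ≤ b ^ L := hb.trans (Nat.le_self_pow hL.ne' b)
  set M : ℕ → ℕ := fun r => (N + L - 1 - r) / L with hM
  have hMsum : ∑ r ∈ Finset.range L, M r = N := by
    have := sum_range_eq_sum_residues hL N (fun _ => (1 : ℕ))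
    simpa using this.symm
  -- Hölder is applied with all `L` exponents equal to `1 / L`, so each residue class is taken at
  -- the parameter `L * t`.
  have hexp : ∀ x, ENNReal.ofReal (Real.exp (t * devSum b u v N x))
      = ∏ r ∈ Finset.range L,
        ENNReal.ofReal (Real.exp (L * t * devSum (b ^ L) u v (M r) (orbit b x r))) ^ (1 / (L : ℝ)) := by
    intro x
    rw [devSum_eq_sum_devSum hL, Finset.mul_sum, Real.exp_sum,
      ENNReal.ofReal_prod_of_nonneg fun _ _ => (Real.exp_pos _).le]
    refine Finset.prod_congr rfl fun r _ => ?_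
    rw [ENNReal.ofReal_rpow_of_pos (Real.exp_pos _), ← Real.exp_mul]
    congr 2
    field_simp
    rfl
  simp only [hexp]
  have hmeas : ∀ r, Measurable fun x => Real.exp (L * t * devSum (b ^ L) u v (M r) x) := fun r =>
    ((measurable_devSum (b ^ L) u v (M r)).const_mul _).exp
  refine (ENNReal.lintegral_prod_norm_pow_le _
    (fun r _ => ((hmeas r).comp (measurable_orbit b r)).ennreal_ofReal.aemeasurable)
    (by simp [hL'.ne']) (fun _ _ => by positivity)).trans ?_
  calc _ ≤ ∏ r ∈ Finset.range L,
        ENNReal.ofReal (Real.exp ((M r * ψ + L * |t| / ((b : ℝ) ^ L - 1)) * (1 / (L : ℝ)))) := by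
        refine Finset.prod_le_prod' fun r _ => ?_
        have h1 := lintegral_comp_orbit (b := b) (by lia) r (hmeas r) fun _ => (Real.exp_pos _).le
        have h2 := lintegral_exp_devSum_le hB h (M r)
        rw [Real.exp_mul, ← ENNReal.ofReal_rpow_of_pos (Real.exp_pos _)]
        refine ENNReal.rpow_le_rpow ?_ (by positivity)
        refine (le_of_eq h1).trans (h2.trans_eq ?_)
        rw [abs_mul, Nat.abs_cast]
        push_cast
        rfl
    _ = _ := by
        rw [← ENNReal.ofReal_prod_of_nonneg fun _ _ => (Real.exp_pos _).le, ← Real.exp_sum,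
          ← Finset.sum_mul, Finset.sum_add_distrib, ← Finset.sum_mul, ← Nat.cast_sum, hMsum]
        simp only [Finset.sum_const, Finset.card_range, nsmul_eq_mul]
        congr 2
        field_simp

/-! ### Chernoff bounds for a block of the orbit -/

theorem F_orbit_eq {b : ℕ} {u v : ℝ} (hu : 0 ≤ u) (hv : v ≤ 1) (huv : u ≤ v) (M N : ℕ) (x : ℝ) :
    F M N u v (orbit b x) = |devSum b u v N (orbit b x M)| := by
  rw [F, devSum]
  congr 1
  have h1 : ∀ j, dev b u v 0 (orbit b (orbit b x M) j)
      = (if u ≤ orbit b x (M + j) ∧ orbit b x (M + j) < v then 1 else 0) - (v - u) := by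
    intro j
    have := orbit_orbit b x M j 1
    rw [pow_one, one_mul] at this
    rw [this]
    exact dev_zero hu hv huv b (orbit_mem_Ico b x _)
  simp only [h1, Finset.sum_sub_distrib, Finset.sum_boole, Finset.sum_const, Finset.card_range,
    nsmul_eq_mul]
  have hcard : visits M N u v (orbit b x) = ((Finset.range N).filter
      fun j => u ≤ orbit b x (M + j) ∧ orbit b x (M + j) < v).card := by
    refine Eq.trans ?_ (Finset.card_map (addLeftEmbedding M))
    rw [visits]
    congr 1
    ext j
    simp only [Finset.mem_filter, Finset.mem_Ico, Finset.mem_map, addLeftEmbedding_apply,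
      Finset.mem_range]
    constructor
    · rintro ⟨⟨h1, h2⟩, h3⟩
      exact ⟨j - M, ⟨by lia, by rwa [Nat.add_sub_cancel' h1]⟩, Nat.add_sub_cancel' h1⟩
    · rintro ⟨i, ⟨h2, h3⟩, rfl⟩
      exact ⟨⟨by lia, by lia⟩, h3⟩
  rw [hcard]
  ring

theorem F_le {u v : ℝ} (hu : 0 ≤ u) (hv : v ≤ 1) (huv : u ≤ v) (M N : ℕ) (y : ℕ → ℝ) :
    F M N u v y ≤ N := by
  have h1 : (visits M N u v y : ℝ) ≤ N := by
    have : visits M N u v y ≤ N := (Finset.card_filter_le _ _).trans (by simp)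
    exact_mod_cast this
  have h2 : (0 : ℝ) ≤ visits M N u v y := Nat.cast_nonneg _
  have h3 : (v - u) * (N : ℝ) ≤ N := mul_le_of_le_one_left (Nat.cast_nonneg _) (by linarith)
  have h4 : 0 ≤ (v - u) * (N : ℝ) := mul_nonneg (by linarith) (Nat.cast_nonneg _)
  rw [F, abs_le]
  constructor <;> linarith

/-- Chernoff's bound for the deviations `F` along an orbit. -/
theorem volume_le_F_le {b : ℕ} (hb : 2 ≤ b) {u v t E : ℝ} (hu : 0 ≤ u) (hv : v ≤ 1) (huv : u ≤ v)
    (ht : 0 ≤ t) (M N : ℕ) (R : ℝ)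
    (h1 : ∫⁻ x in Ico (0 : ℝ) 1, ENNReal.ofReal (Real.exp (t * devSum b u v N x))
      ≤ ENNReal.ofReal (Real.exp E))
    (h2 : ∫⁻ x in Ico (0 : ℝ) 1, ENNReal.ofReal (Real.exp (-t * devSum b u v N x))
      ≤ ENNReal.ofReal (Real.exp E)) :
    volume {x | x ∈ Ioo (0 : ℝ) 1 ∧ R ≤ F M N u v (orbit b x)}
      ≤ ENNReal.ofReal (2 * Real.exp (E - t * R)) := by
  have hm : ∀ s : ℝ, Measurable fun x => Real.exp (s * devSum b u v N x) := fun s =>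
    ((measurable_devSum b u v N).const_mul s).exp
  set g : ℝ → ℝ := fun y => Real.exp (t * devSum b u v N y) + Real.exp (-t * devSum b u v N y)
    with hg
  have hgm : Measurable g := (hm t).add (hm (-t))
  have hg0 : ∀ y, 0 ≤ g y := fun y => add_nonneg (Real.exp_pos _).le (Real.exp_pos _).le
  have hint : ∫⁻ x in Ico (0 : ℝ) 1, ENNReal.ofReal (g (orbit b x M))
      ≤ ENNReal.ofReal (2 * Real.exp E) := by
    rw [lintegral_comp_orbit (by lia) M hgm hg0]
    simp only [hg, ENNReal.ofReal_add (Real.exp_pos _).le (Real.exp_pos _).le]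
    rw [lintegral_add_left (hm t).ennreal_ofReal, two_mul,
      ENNReal.ofReal_add (Real.exp_pos _).le (Real.exp_pos _).le]
    gcongr
  have hsub : {x | x ∈ Ioo (0 : ℝ) 1 ∧ R ≤ F M N u v (orbit b x)}
      ⊆ {x | ENNReal.ofReal (Real.exp (t * R)) ≤ ENNReal.ofReal (g (orbit b x M))}
        ∩ Ico (0 : ℝ) 1 := by
    rintro x ⟨hx, hR⟩
    refine ⟨ENNReal.ofReal_le_ofReal ?_, Ioo_subset_Ico_self hx⟩
    rw [F_orbit_eq hu hv huv] at hR
    set S := devSum b u v N (orbit b x M)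
    have : Real.exp (t * R) ≤ Real.exp (t * |S|) :=
      Real.exp_le_exp.2 (mul_le_mul_of_nonneg_left hR ht)
    refine this.trans ?_
    simp only [hg]
    rcases abs_choice S with h | h <;> rw [h]
    · linarith [Real.exp_pos (-t * S)]
    · rw [mul_neg, ← neg_mul]
      linarith [Real.exp_pos (t * S)]
  have hmk := meas_ge_le_lintegral_div (μ := volume.restrict (Ico (0 : ℝ) 1))
    (hgm.comp (measurable_orbit b M)).ennreal_ofReal.aemeasurable
    (ε := ENNReal.ofReal (Real.exp (t * R))) (by simp [Real.exp_pos]) ENNReal.ofReal_ne_top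
  rw [Measure.restrict_apply' measurableSet_Ico] at hmk
  refine (measure_mono hsub).trans (hmk.trans ?_)
  refine (ENNReal.div_le_div_right hint _).trans_eq ?_
  rw [← ENNReal.ofReal_div_of_pos (Real.exp_pos _), Real.exp_sub, mul_div_assoc]

theorem volume_le_F_hoeffding {b : ℕ} (hb : 2 ≤ b) {u v : ℝ} (hu : 0 ≤ u) (hv : v ≤ 1)
    (huv : u ≤ v) (M : ℕ) {N : ℕ} (hN : 0 < N) {R : ℝ} (hR : 0 < R) :
    volume {x | x ∈ Ioo (0 : ℝ) 1 ∧ R ≤ F M N u v (orbit b x)}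
      ≤ ENNReal.ofReal (2 * Real.exp (1 - 2 * R ^ 2 / (N * ((b : ℝ) / (b - 1)) ^ 2))) := by
  have hb' : (2 : ℝ) ≤ b := by exact_mod_cast hb
  have hN' : (0 : ℝ) < N := by exact_mod_cast hN
  rcases lt_or_ge (N : ℝ) R with hRN | hRN
  · have : {x | x ∈ Ioo (0 : ℝ) 1 ∧ R ≤ F M N u v (orbit b x)} = ∅ := by
      ext x
      simp only [mem_ofPred_eq, mem_empty_iff_false, iff_false, not_and, not_le]
      exact fun _ => (F_le hu hv huv M N _).trans_lt hRN
    rw [this]; simp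
  · set c : ℝ := (b : ℝ) / (b - 1) with hc
    have hb1 : (0 : ℝ) < (b : ℝ) - 1 := by linarith
    have hc0 : 0 < c := by positivity
    -- The minimiser of `N t² c² / 8 - t R`. As `R ≤ N` in this branch, the boundary term satisfies
    -- `t / (b - 1) ≤ 4 (b - 1) / b² ≤ 1`, which is the `1` in the exponent.
    set t : ℝ := 4 * R / (N * c ^ 2) with ht
    have ht0 : 0 < t := by positivity
    have hE : ∀ s : ℝ, |s| = t →
        ∫⁻ x in Ico (0 : ℝ) 1, ENNReal.ofReal (Real.exp (s * devSum b u v N x))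
          ≤ ENNReal.ofReal (Real.exp (N * (t ^ 2 * c ^ 2 / 8) + t / (b - 1))) := by
      intro s hs
      have := lintegral_exp_devSum_le hb (u := u) (v := v) (t := s)
        (fun K x _ => avg_exp_le_hoeffding hb u v s K x) N
      rwa [hs, ← sq_abs, hs] at this
    refine (volume_le_F_le hb hu hv huv ht0.le M N R (hE t (abs_of_pos ht0))
      (hE (-t) (by rw [abs_neg, abs_of_pos ht0]))).trans (ENNReal.ofReal_le_ofReal ?_)
    refine mul_le_mul_of_nonneg_left (Real.exp_le_exp.2 ?_) (by norm_num)
    have h1 : (N : ℝ) * (t ^ 2 * c ^ 2 / 8) - t * R = - (2 * R ^ 2 / (N * c ^ 2)) := by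
      rw [ht]; field_simp; ring
    have h2 : t / (b - 1) ≤ 1 := by
      rw [div_le_one hb1, ht, hc, div_le_iff₀ (by positivity)]
      have : ((b : ℝ) - 1) * (N * (b / (b - 1)) ^ 2) = N * (b ^ 2 / (b - 1)) := by field_simp
      rw [this]
      have h4 : (4 : ℝ) ≤ b ^ 2 / (b - 1) := by
        rw [le_div_iff₀ hb1]; nlinarith [sq_nonneg ((b : ℝ) - 2)]
      nlinarith
    linarith

theorem volume_le_F_bernstein {b L : ℕ} (hb : 2 ≤ b) (hB : 32 ≤ b ^ L) {u v : ℝ} (hu : 0 ≤ u)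
    (hv : v ≤ 1) (hp : 1 ≤ (v - u) * b ^ L) (M N : ℕ) (R : ℝ) {t : ℝ} (ht : 0 ≤ t)
    (htL : L * t ≤ 15 / 16) :
    volume {x | x ∈ Ioo (0 : ℝ) 1 ∧ R ≤ F M N u v (orbit b x)}
      ≤ ENNReal.ofReal (2 * Real.exp (1 / 25 + 13 / 8 * (v - u) * t ^ 2 * L * N - t * R)) := by
  have hL : 0 < L := by
    rcases Nat.eq_zero_or_pos L with h | h
    · rw [h] at hB; simp at hB
    · exact h
  have hL' : (0 : ℝ) < L := by exact_mod_cast hL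
  have hB' : (32 : ℝ) ≤ (b : ℝ) ^ L := by exact_mod_cast hB
  have huv : u ≤ v := by
    by_contra hneg
    have : (v - u) * (b : ℝ) ^ L ≤ 0 :=
      mul_nonpos_of_nonpos_of_nonneg (by linarith) (by linarith)
    linarith
  have hE : ∀ s : ℝ, |s| = t →
      ∫⁻ x in Ico (0 : ℝ) 1, ENNReal.ofReal (Real.exp (s * devSum b u v N x))
        ≤ ENNReal.ofReal (Real.exp (1 / 25 + 13 / 8 * (v - u) * t ^ 2 * L * N)) := by
    intro s hs
    have habs : |(L : ℝ) * s| = L * t := by rw [abs_mul, hs, Nat.abs_cast]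
    refine (lintegral_exp_devSum_le_of_pow hb hL (u := u) (v := v) (t := s)
      (fun K x hx => avg_exp_le_bernstein hB hu hv (by exact_mod_cast hp)
        (by rw [habs]; exact htL) K hx) N).trans (ENNReal.ofReal_le_ofReal ?_)
    refine Real.exp_le_exp.2 ?_
    have h1 : (N : ℝ) * (13 / 8 * (v - u) * (L * s) ^ 2) / L
        = 13 / 8 * (v - u) * t ^ 2 * L * N := by
      rw [← hs, sq_abs]; field_simp
    rw [h1, hs]
    -- The boundary term is at most `(15 / 16) / 31`.
    have h2 : L * t / ((b : ℝ) ^ L - 1) ≤ 1 / 25 := by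
      rw [div_le_iff₀ (by linarith)]; linarith
    linarith
  refine (volume_le_F_le hb hu hv huv ht M N R (hE t (abs_of_nonneg ht))
    (hE (-t) (by rw [abs_neg, abs_of_nonneg ht])))

/-! ### Numerical estimates for the exponents -/

theorem one_le_two_mul_Ctilde {b : ℕ} (hb : 2 ≤ b) : 1 ≤ 2 * Ctilde b := by
  have hs : 1 < Real.sqrt b := Real.lt_sqrt_of_sq_lt (by rw [one_pow]; exact_mod_cast hb)
  have : 0 < 2 / (Real.sqrt b - 1) := div_pos two_pos (by linarith)
  rw [Ctilde]
  linarith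

theorem div_pred_le_two_mul_Ctilde {b : ℕ} (hb : 2 ≤ b) : (b : ℝ) / (b - 1) ≤ 2 * Ctilde b := by
  have hb' : (2 : ℝ) ≤ b := by exact_mod_cast hb
  have hs : 1 < Real.sqrt b := Real.lt_sqrt_of_sq_lt (by linarith)
  have hsq : Real.sqrt b ^ 2 = b := Real.sq_sqrt (by linarith)
  have h1 : (b : ℝ) / (b - 1) = 1 + 1 / (b - 1) := by
    have : (b : ℝ) - 1 ≠ 0 := by linarith
    field_simp
    ring
  have h2 : 1 / ((b : ℝ) - 1) ≤ 4 / (Real.sqrt b - 1) := by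
    rw [div_le_div_iff₀ (by linarith) (by linarith)]
    nlinarith
  have h3 : 2 * Ctilde b = 1 + 4 / (Real.sqrt b - 1) := by rw [Ctilde]; ring
  rw [h1, h3]
  linarith

/-- The loss in the Bernstein bound is the least `L` with `b ^ L ≥ 2 ^ (h + 1)`. For `b ≥ 16` it is
at most `(h + 4) / 4`; for smaller bases it is larger, but so is `2 * Ctilde b`: at least `4` when
`b < 4` and at least `2` when `b < 16`. -/
theorem clog_le_mul_Ctilde {b : ℕ} (hb : 2 ≤ b) (h : ℕ) :
    (Nat.clog b (2 ^ (h + 1)) : ℝ) ≤ ((h : ℝ) + 4) / 4 * (2 * Ctilde b) := by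
  have hb' : (2 : ℝ) ≤ b := by exact_mod_cast hb
  have hs : 1 < Real.sqrt b := Real.lt_sqrt_of_sq_lt (by linarith)
  have h3 : 2 * Ctilde b = 1 + 4 / (Real.sqrt b - 1) := by rw [Ctilde]; ring
  have hh : (0 : ℝ) ≤ h := Nat.cast_nonneg h
  have key : ∀ y c : ℝ, 1 < y → (b : ℝ) ≤ y ^ 2 → 1 + 4 / (y - 1) ≥ c → c ≤ 2 * Ctilde b := by
    intro y c hy hby hc
    have : Real.sqrt b ≤ y := by
      rw [Real.sqrt_le_left (by linarith)]; exact hby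
    have : 4 / (y - 1) ≤ 4 / (Real.sqrt b - 1) := by
      apply div_le_div_of_nonneg_left <;> linarith
    rw [h3]; linarith
  rcases lt_or_ge b 4 with h4 | h4
  · have hL : Nat.clog b (2 ^ (h + 1)) ≤ h + 1 :=
      Nat.clog_le_of_le_pow (Nat.pow_le_pow_left hb _)
    have hL' : (Nat.clog b (2 ^ (h + 1)) : ℝ) ≤ h + 1 := by exact_mod_cast hL
    have hb3 : (b : ℝ) ≤ 3 := by exact_mod_cast (by lia : b ≤ 3)
    have := key 2 4 (by norm_num) (by linarith) (by norm_num)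
    nlinarith
  rcases lt_or_ge b 16 with h16 | h16
  · have hL : Nat.clog b (2 ^ (h + 1)) ≤ (h + 2) / 2 := by
      refine Nat.clog_le_of_le_pow ?_
      calc 2 ^ (h + 1) ≤ 2 ^ (2 * ((h + 2) / 2)) := Nat.pow_le_pow_right two_pos (by lia)
        _ = 4 ^ ((h + 2) / 2) := by rw [pow_mul]; norm_num
        _ ≤ _ := Nat.pow_le_pow_left h4 _
    have hL' : (Nat.clog b (2 ^ (h + 1)) : ℝ) ≤ ((h : ℝ) + 2) / 2 := by
      rw [le_div_iff₀ two_pos]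
      exact_mod_cast (by lia : Nat.clog b (2 ^ (h + 1)) * 2 ≤ h + 2)
    have hb15 : (b : ℝ) ≤ 15 := by exact_mod_cast (by lia : b ≤ 15)
    have := key 4 2 (by norm_num) (by linarith) (by norm_num)
    nlinarith
  · have hL : Nat.clog b (2 ^ (h + 1)) ≤ (h + 4) / 4 := by
      refine Nat.clog_le_of_le_pow ?_
      calc 2 ^ (h + 1) ≤ 2 ^ (4 * ((h + 4) / 4)) := Nat.pow_le_pow_right two_pos (by lia)
        _ = 16 ^ ((h + 4) / 4) := by rw [pow_mul]; norm_num
        _ ≤ _ := Nat.pow_le_pow_left h16 _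
    have hL' : (Nat.clog b (2 ^ (h + 1)) : ℝ) ≤ ((h : ℝ) + 4) / 4 := by
      rw [le_div_iff₀ (by norm_num)]
      exact_mod_cast (by lia : Nat.clog b (2 ^ (h + 1)) * 4 ≤ h + 4)
    have := one_le_two_mul_Ctilde hb
    nlinarith

theorem two_le_of_exp_lt {δ : ℝ} (hδ : 0 < δ) {n : ℕ}
    (hn : Real.exp (6 / (δ * Real.log 2)) < n) : 2 ≤ n := by
  have h1 : (1 : ℝ) < n := by
    refine lt_of_le_of_lt ?_ hn
    have := Real.log_pos one_lt_two
    exact Real.one_le_exp (by positivity)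
  exact_mod_cast h1

/-- The hypothesis on `n` says `δ log n > 6 / log 2`, and `6 / log 2 > 8.65`. -/
theorem le_mul_log_of_exp_lt {δ : ℝ} (hδ : 0 < δ) {n : ℕ}
    (hn : Real.exp (6 / (δ * Real.log 2)) < n) : 8.65 ≤ δ * Real.log n := by
  have hl := Real.log_pos one_lt_two
  have hn0 : (0 : ℝ) < n := (Real.exp_pos _).trans hn
  have h1 := (Real.lt_log_iff_exp_lt hn0).2 hn
  rw [div_lt_iff₀ (by positivity)] at h1
  have h2 := Real.log_two_lt_d9
  have h3 : 0 < δ * Real.log n := by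
    by_contra hneg
    nlinarith [mul_nonpos_of_nonpos_of_nonneg (not_lt.1 hneg) hl.le]
  by_contra hneg
  have : (δ * Real.log n) * Real.log 2 ≤ 8.65 * Real.log 2 :=
    mul_le_mul_of_nonneg_right (not_le.1 hneg).le hl.le
  nlinarith

theorem log_sub_le_log_log {n : ℕ} (hn : 1 ≤ n) :
    Real.log n - 0.38 ≤ Real.log (Real.log (2 ^ n)) := by
  have hl := Real.log_pos one_lt_two
  have hn0 : (0 : ℝ) < n := by exact_mod_cast hn
  rw [Real.log_pow, Real.log_mul hn0.ne' hl.ne']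
  have : -0.38 ≤ Real.log (Real.log 2) := by
    rw [Real.le_log_iff_exp_le hl, Real.exp_neg]
    have h1 := Real.quadratic_le_exp_of_nonneg (x := 0.38) (by norm_num)
    have h2 := Real.log_two_gt_d9
    refine (inv_anti₀ (by norm_num) h1).trans ?_
    refine le_trans ?_ h2.le
    norm_num
  linarith

/-- The quantities entering the exponents of the tail bounds: `x = log n`, `l = log log 2 ^ n`. -/
theorem exponent_facts {δ x l : ℝ} (hδ : 0 < δ) (hx2 : 0.693 ≤ x) (hδx : 8.65 ≤ δ * x)
    (hl : x - 0.38 ≤ l) :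
    (1 + 4 * δ) * x + 10 ≤ 1.1 * ((1 + 2 * δ) ^ 2 * l) ∧ 34 ≤ (1 + 2 * δ) ^ 2 * l := by
  have h0 : (1 + 2 * δ) ^ 2 * (x - 0.38) ≤ (1 + 2 * δ) ^ 2 * l :=
    mul_le_mul_of_nonneg_left hl (sq_nonneg _)
  have h1 : 0.45 * (δ * x) ≤ δ * x - 0.38 * δ := by nlinarith
  have h2 : (1 + 4 * δ) * x + 14 * δ - 0.38 ≤ (1 + 2 * δ) ^ 2 * (x - 0.38) := by
    nlinarith [mul_pos hδ hδ]
  -- Arithmetic-geometric mean with `δ * x ≥ 8.65`: the product of the two terms is bounded below,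
  -- so either `x` or `δ` is large.
  have h3 : 7 ≤ 0.1 * x + 15.4 * δ := by
    nlinarith [sq_nonneg (0.1 * x - 15.4 * δ)]
  constructor <;> nlinarith

/-- The coefficients are roundings: `1.4` exceeds `2 log 2`, and `2.4` exceeds `1 + 2 log 2`. -/
theorem two_mul_exp_le_of_le {δ E : ℝ} {n i h : ℕ} (hn : 1 ≤ n)
    (hE : (1 + 4 * δ) * Real.log n + 1.4 * (i + h) + 2.4 ≤ E) :
    2 * Real.exp (1 - E) ≤ (n : ℝ) ^ (-1 - 4 * δ) * (1 / 4) ^ i * (1 / 2) ^ (2 * h + 1) := by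
  have hn0 : (0 : ℝ) < n := by exact_mod_cast hn
  have h2 : ∀ m : ℕ, ((1 : ℝ) / 2) ^ m = Real.exp (-(m * Real.log 2)) := by
    intro m
    rw [Real.exp_neg, ← Real.log_pow, Real.exp_log (by positivity)]
    simp
  have h4 : ((1 : ℝ) / 4) ^ i = (1 / 2) ^ (2 * i) := by
    rw [pow_mul]; norm_num
  rw [Real.rpow_def_of_pos hn0, h4, h2, h2, ← Real.exp_add, ← Real.exp_add]
  nth_rewrite 1 [← Real.exp_log two_pos]
  rw [← Real.exp_add, Real.exp_le_exp]
  push_cast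
  have hl := Real.log_two_lt_d9
  have hi : (0 : ℝ) ≤ i := Nat.cast_nonneg i
  have hh : (0 : ℝ) ≤ h := Nat.cast_nonneg h
  nlinarith

theorem one_add_mul_le_two_rpow {c e : ℝ} (_ : 0 ≤ c) (h : 1 + c ≤ (2 : ℝ) ^ e) (m : ℕ) :
    1 + c * m ≤ (2 : ℝ) ^ (e * m) := by
  rw [Real.rpow_mul_natCast zero_le_two]
  have := one_add_mul_le_pow (a := c) (by linarith) m
  rw [mul_comm c]
  exact this.trans (pow_le_pow_left₀ (by linarith) h m)

theorem le_two_rpow_of_pow_le {c : ℝ} {p q : ℕ} (hq : q ≠ 0) (h : c ^ q ≤ 2 ^ p) :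
    c ≤ (2 : ℝ) ^ ((p : ℝ) / q) := by
  have hq' : (q : ℝ) ≠ 0 := by exact_mod_cast hq
  refine le_of_pow_le_pow_left₀ hq (by positivity) (h.trans_eq ?_)
  rw [← Real.rpow_mul_natCast zero_le_two, div_mul_cancel₀ _ hq', Real.rpow_natCast]

theorem sq_two_rpow_third (i : ℕ) : 1 + 0.58 * (i : ℝ) ≤ ((2 : ℝ) ^ ((i : ℝ) / 3)) ^ 2 := by
  have h := one_add_mul_le_two_rpow (c := 0.58) (e := 2 / 3) (by norm_num)
    (by exact_mod_cast le_two_rpow_of_pow_le (c := 1 + 0.58) (p := 2) (q := 3)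
          (by norm_num) (by norm_num)) i
  rw [← Real.rpow_mul_natCast zero_le_two]
  convert h using 2
  push_cast; ring

theorem mul_le_two_rpow_three_quarters {h : ℕ} (hh : 4 ≤ h) :
    ((h : ℝ) + 4) * (1 + 0.4 * ((h : ℝ) - 4)) ≤ (2 : ℝ) ^ (3 / 4 * (h : ℝ)) := by
  obtain ⟨v, rfl⟩ := Nat.exists_eq_add_of_le hh
  have hv : (0 : ℝ) ≤ v := Nat.cast_nonneg v
  have h1 := one_add_mul_le_two_rpow (c := 0.4) (e := 1 / 2) (by norm_num)
    (by exact_mod_cast le_two_rpow_of_pow_le (c := 1 + 0.4) (p := 1) (q := 2)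
          (by norm_num) (by norm_num)) v
  have h2 := one_add_mul_le_two_rpow (c := 0.125) (e := 1 / 4) (by norm_num)
    (by exact_mod_cast le_two_rpow_of_pow_le (c := 1 + 0.125) (p := 1) (q := 4)
          (by norm_num) (by norm_num)) v
  have h3 : (2 : ℝ) ^ (3 / 4 * ((4 + v : ℕ) : ℝ))
      = 8 * ((2 : ℝ) ^ ((1 / 2 : ℝ) * v) * (2 : ℝ) ^ ((1 / 4 : ℝ) * v)) := by
    rw [← Real.rpow_add two_pos, show (8 : ℝ) = 2 ^ (3 : ℝ) by norm_num, ← Real.rpow_add two_pos]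
    congr 1
    push_cast
    ring
  rw [h3]
  have h4 := mul_le_mul h1 h2 (by positivity) (by positivity)
  push_cast
  nlinarith

/-- Substituting the lower bounds for `i` and `r`, the exponent on the right is at least `11 / 2 + 5
(h - 4) / 24 + (n - 16) / 3`; Bernoulli's inequality then gives linear factors in `h` and `n`. -/
theorem le_two_rpow_capped {n h r i : ℕ} (hn : 16 ≤ n) (hh : 4 ≤ h) (h2 : 2 * h ≤ r + 2)
    (hr : n ≤ r + 1 + i) :
    45 / 8 * ((h : ℝ) + 4) * (1 + 0.11 * ((n : ℝ) - 16)) ^ 2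
      ≤ (2 : ℝ) ^ (-(h : ℝ) / 8) * (2 : ℝ) ^ ((i : ℝ) / 3) * (2 : ℝ) ^ ((r : ℝ) / 2) := by
  obtain ⟨v, rfl⟩ := Nat.exists_eq_add_of_le hh
  obtain ⟨u, rfl⟩ := Nat.exists_eq_add_of_le hn
  have hv : (0 : ℝ) ≤ v := Nat.cast_nonneg v
  have hu : (0 : ℝ) ≤ u := Nat.cast_nonneg u
  have h3 := one_add_mul_le_two_rpow (c := 0.125) (e := 5 / 24) (by norm_num)
    (by exact_mod_cast le_two_rpow_of_pow_le (c := 1 + 0.125) (p := 5) (q := 24)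
          (by norm_num) (by norm_num)) v
  have h4 := one_add_mul_le_two_rpow (c := 0.11) (e := 1 / 6) (by norm_num)
    (by exact_mod_cast le_two_rpow_of_pow_le (c := 1 + 0.11) (p := 1) (q := 6)
          (by norm_num) (by norm_num)) u
  have h5 : (45 : ℝ) ≤ 2 ^ ((11 : ℝ) / 2) := by
    exact_mod_cast le_two_rpow_of_pow_le (c := 45) (p := 11) (q := 2)
      (by norm_num) (by norm_num)
  have h6 : (2 : ℝ) ^ ((11 : ℝ) / 2) * (2 : ℝ) ^ ((5 / 24 : ℝ) * v)
        * ((2 : ℝ) ^ ((1 / 6 : ℝ) * u)) ^ 2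
      ≤ (2 : ℝ) ^ (-((4 + v : ℕ) : ℝ) / 8) * (2 : ℝ) ^ ((i : ℝ) / 3) * (2 : ℝ) ^ ((r : ℝ) / 2) := by
    rw [← Real.rpow_mul_natCast zero_le_two, ← Real.rpow_add two_pos, ← Real.rpow_add two_pos,
      ← Real.rpow_add two_pos, ← Real.rpow_add two_pos]
    refine Real.rpow_le_rpow_of_exponent_le one_le_two ?_
    have h2' : 2 * (4 + (v : ℝ)) ≤ r + 2 := by exact_mod_cast h2
    have hr' : 16 + (u : ℝ) ≤ r + 1 + i := by exact_mod_cast hr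
    push_cast
    linarith
  refine le_trans ?_ h6
  have h7 : 45 * (1 + 0.125 * (v : ℝ)) * (1 + 0.11 * (u : ℝ)) ^ 2
      ≤ (2 : ℝ) ^ ((11 : ℝ) / 2) * (2 : ℝ) ^ ((5 / 24 : ℝ) * v)
        * ((2 : ℝ) ^ ((1 / 6 : ℝ) * u)) ^ 2 := by gcongr
  refine le_trans (le_of_eq ?_) h7
  push_cast
  ring

/-- The threshold for a block of length `2 ^ r`; the sets `G(b, n, a, h)` have `r = n`, `i = 0`, and
the sets `H(b, n, a, h, l, m)` have `r = l - 1`, `i = n - l`. -/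
noncomputable def threshold (δ : ℝ) (b n r i h : ℕ) : ℝ :=
  (2 : ℝ) ^ (-(h : ℝ) / 8) * (2 : ℝ) ^ ((i : ℝ) / 3) *
    ((1 + 2 * δ) * (2 * Ctilde b) * Real.sqrt (2 ^ r * Real.log (Real.log (2 ^ n))))

theorem threshold_sq {δ : ℝ} {b n r i h : ℕ} (hl : 0 ≤ Real.log (Real.log (2 ^ n))) :
    threshold δ b n r i h ^ 2 = (2 : ℝ) ^ (-(h : ℝ) / 4) * ((2 : ℝ) ^ ((i : ℝ) / 3)) ^ 2 *
      ((1 + 2 * δ) ^ 2 * Real.log (Real.log (2 ^ n))) * (2 * Ctilde b) ^ 2 * 2 ^ r := by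
  rw [threshold, mul_pow, mul_pow, mul_pow ((1 + 2 * δ) * _), Real.sq_sqrt (by positivity),
    ← Real.rpow_mul_natCast zero_le_two (-(h : ℝ) / 8)]
  have : -(h : ℝ) / 8 * (2 : ℕ) = -(h : ℝ) / 4 := by push_cast; ring
  rw [this]
  ring

theorem threshold_pos {δ : ℝ} (hδ : 0 < δ) {b n r i h : ℕ} (hb : 2 ≤ b)
    (hl : 0 < Real.log (Real.log (2 ^ n))) : 0 < threshold δ b n r i h := by
  have := one_le_two_mul_Ctilde hb
  have h2 : 0 < 2 * Ctilde b := by linarith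
  unfold threshold
  positivity

theorem hoeffding_exponent {δ : ℝ} (hδ : 0 < δ) {n b r i h : ℕ} (hb : 2 ≤ b)
    (hl : 0 < Real.log (Real.log (2 ^ n))) {c : ℝ} (hc : c ≤ 2 * (2 : ℝ) ^ (-(h : ℝ) / 4)) :
    c * ((2 : ℝ) ^ ((i : ℝ) / 3)) ^ 2 * ((1 + 2 * δ) ^ 2 * Real.log (Real.log (2 ^ n)))
      ≤ 2 * threshold δ b n r i h ^ 2 / ((2 ^ r : ℕ) * ((b : ℝ) / (b - 1)) ^ 2) := by
  have hb' : (2 : ℝ) ≤ b := by exact_mod_cast hb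
  have hb1 : (0 : ℝ) < (b : ℝ) - 1 := by linarith
  have hcb := div_pred_le_two_mul_Ctilde hb
  have hcpos : 0 < (b : ℝ) / (b - 1) := by positivity
  rw [threshold_sq hl.le, le_div_iff₀ (by positivity)]
  have h2 : ((b : ℝ) / (b - 1)) ^ 2 ≤ (2 * Ctilde b) ^ 2 := pow_le_pow_left₀ hcpos.le hcb 2
  have h3 : 0 ≤ ((2 : ℝ) ^ ((i : ℝ) / 3)) ^ 2 * ((1 + 2 * δ) ^ 2 * Real.log (Real.log (2 ^ n)))
      * 2 ^ r := by positivity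
  have h4 : c * ((b : ℝ) / (b - 1)) ^ 2
      ≤ 2 * (2 : ℝ) ^ (-(h : ℝ) / 4) * (2 * Ctilde b) ^ 2 :=
    mul_le_mul hc h2 (by positivity) (by positivity)
  have := mul_le_mul_of_nonneg_right h4 h3
  push_cast
  linarith

/-- The unconstrained minimiser of the exponent is `R / (3.25 p L N)`, with value `-R² / (6.5 p L
N)`. If it violates `L * t ≤ 15 / 16`, take `t` at that cap; the quadratic term is then at most half
the linear one, leaving `15 / 32 * R / L`. -/
theorem exists_bernstein_parameter {p L N R : ℝ} (hp : 0 < p) (hL : 0 < L) (hN : 0 < N)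
    (hR : 0 < R) {E : ℝ} (h1 : E ≤ R ^ 2 / (6.5 * p * L * N)) (h2 : E ≤ 15 / 32 * R / L) :
    ∃ t : ℝ, 0 ≤ t ∧ L * t ≤ 15 / 16 ∧ 13 / 8 * p * t ^ 2 * L * N - t * R ≤ -E := by
  rcases le_total (L * (R / (3.25 * p * L * N))) (15 / 16) with h | h
  · refine ⟨R / (3.25 * p * L * N), by positivity, h, ?_⟩
    have : 13 / 8 * p * (R / (3.25 * p * L * N)) ^ 2 * L * N - R / (3.25 * p * L * N) * R
        = -(R ^ 2 / (6.5 * p * L * N)) := by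
      field_simp
      ring
    rw [this]
    linarith
  · refine ⟨15 / 16 / L, by positivity, by rw [mul_div_cancel₀ _ hL.ne'], ?_⟩
    have h3 : p * N ≤ 16 / 15 / 3.25 * R := by
      have : L * (R / (3.25 * p * L * N)) = R / (3.25 * (p * N)) := by field_simp
      rw [this, le_div_iff₀ (by positivity)] at h
      linarith
    have h4 : 13 / 8 * p * (15 / 16 / L) ^ 2 * L * N = 13 / 8 * (15 / 16) ^ 2 / L * (p * N) := by
      field_simp
    have h5 : 13 / 8 * (15 / 16) ^ 2 / L * (p * N)
        ≤ 13 / 8 * (15 / 16) ^ 2 / L * (16 / 15 / 3.25 * R) := by gcongr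
    have h6 : 13 / 8 * (15 / 16) ^ 2 / L * (16 / 15 / 3.25 * R) - 15 / 16 / L * R
        = -(15 / 32 * R / L) := by field_simp; ring
    rw [h4]
    linarith

theorem exponent_le_of_le_three {h i : ℕ} (h3 : h ≤ 3) {A Q θ : ℝ} (hQA : A + 10 ≤ 1.1 * Q)
    (hQ : 34 ≤ Q) (hθ : 1 + 0.58 * (i : ℝ) ≤ θ) : A + 1.4 * (i + h) + 2.4 ≤ 1.18 * θ * Q := by
  have h3' : (h : ℝ) ≤ 3 := by exact_mod_cast h3
  have hi0 : (0 : ℝ) ≤ i := Nat.cast_nonneg i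
  have hiQ : 34 * (i : ℝ) ≤ Q * i := by gcongr
  nlinarith

theorem exponent_le_of_le_fifteen {δ Q θ : ℝ} (hδ : 0 < δ) {n h i : ℕ} (h6 : 6 ≤ n) (h15 : n ≤ 15)
    (h8 : h ≤ 8) (hδx : 8.65 ≤ δ * Real.log n) (hQ : 34 ≤ Q)
    (hQ2 : (1 + 2 * δ) ^ 2 * (Real.log n - 0.38) ≤ Q) (hθ : 1 + 0.58 * (i : ℝ) ≤ θ) :
    (1 + 4 * δ) * Real.log n + 1.4 * (i + h) + 2.4 ≤ 0.5 * θ * Q := by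
  have h8' : (h : ℝ) ≤ 8 := by exact_mod_cast h8
  have hi0 : (0 : ℝ) ≤ i := Nat.cast_nonneg i
  have hiQ : 34 * (i : ℝ) ≤ Q * i := by gcongr
  have hxlo : 1.6 ≤ Real.log n := by
    rw [Real.le_log_iff_exp_le (by exact_mod_cast (by lia : 0 < n))]
    have h1 : Real.exp 1.6 ≤ 6 := by
      have : Real.exp 1.6 = Real.exp 1 * Real.exp 0.6 := by rw [← Real.exp_add]; norm_num
      have h2 := Real.exp_one_lt_d9
      have h3 := exp_le_one_add_add_sq (y := 0.6) (by norm_num [abs_of_pos])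
      rw [this]
      nlinarith [Real.exp_pos 0.6, Real.exp_pos 1]
    exact h1.trans (by exact_mod_cast h6)
  have hxhi : Real.log n ≤ 2.78 := by
    have h1 : Real.log n ≤ Real.log (2 ^ 4) :=
      Real.log_le_log (by exact_mod_cast (by lia : 0 < n))
        (by exact_mod_cast (by lia : n ≤ 2 ^ 4))
    rw [Real.log_pow] at h1
    have := Real.log_two_lt_d9
    push_cast at h1
    linarith
  have hδ3 : 3.1 ≤ δ := by nlinarith
  have hQ3 : (1 + 4 * δ) * Real.log n + 13.6 ≤ 0.5 * Q := by
    have h1 : (1 + 2 * δ) ^ 2 * (0.76 * Real.log n)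
        ≤ (1 + 2 * δ) ^ 2 * (Real.log n - 0.38) :=
      mul_le_mul_of_nonneg_left (by linarith) (sq_nonneg _)
    nlinarith
  nlinarith

/-- The gain is `1 / p = 2 ^ k`, against the threshold factor `2 ^ (-h/4)` and a loss `L` linear in
`h`; so `2 ^ (3h/4)` has to beat `h + 4`. For `k = h + 1` a spare factor `2` gives room; for `k = h`
the room comes from `2h + i ≥ 16`. -/
theorem exponent_le_uncapped {h i k L : ℕ} {A Q θ q : ℝ} (hQA : A + 10 ≤ 1.1 * Q) (hQ : 34 ≤ Q)
    (hθ : 1 + 0.58 * (i : ℝ) ≤ θ) (hh : 4 ≤ h) (hk : k = h + 1 ∨ k = h ∧ 16 ≤ 2 * h + i)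
    (hL : 0 < L) (hLq : (L : ℝ) ≤ ((h : ℝ) + 4) / 4 * q) (hq1 : 1 ≤ q) {N : ℝ} (hN : 0 < N) :
    A + 1.4 * (i + h) + 2.4
      ≤ (2 : ℝ) ^ (-(h : ℝ) / 4) * θ * Q * q ^ 2 * N / (6.5 * (1 / 2 ^ k) * L * N) := by
  have hL' : (0 : ℝ) < L := by exact_mod_cast hL
  have hi0 : (0 : ℝ) ≤ i := Nat.cast_nonneg i
  have hh4 : (4 : ℝ) ≤ h := by exact_mod_cast hh
  have hc : 1.1 + 0.05 * ((i : ℝ) + h - 4)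
      ≤ (2 : ℝ) ^ (-(h : ℝ) / 4) * 2 ^ k * (4 / (6.5 * (h + 4))) * θ := by
    have h34 := mul_le_two_rpow_three_quarters hh
    have hkh : (2 : ℝ) ^ (-(h : ℝ) / 4) * 2 ^ h = (2 : ℝ) ^ (3 / 4 * (h : ℝ)) := by
      rw [← Real.rpow_natCast 2 h, ← Real.rpow_add two_pos]
      congr 1
      ring
    have hbase : 4 / 6.5 * (1 + 0.4 * ((h : ℝ) - 4))
        ≤ (2 : ℝ) ^ (-(h : ℝ) / 4) * 2 ^ h * (4 / (6.5 * (h + 4))) := by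
      rw [hkh]
      have : (4 : ℝ) / (6.5 * (h + 4)) = 4 / 6.5 / (h + 4) := by field_simp
      rw [this, mul_div_assoc', le_div_iff₀ (by linarith)]
      linarith
    have h5 := mul_le_mul hbase hθ (by linarith) (by positivity)
    have h0 : 0 ≤ ((h : ℝ) - 4) * i := mul_nonneg (by linarith) hi0
    rcases hk with hk | ⟨hk, hrh⟩
    · have : (2 : ℝ) ^ (-(h : ℝ) / 4) * 2 ^ k * (4 / (6.5 * (h + 4))) * θ
          = 2 * ((2 : ℝ) ^ (-(h : ℝ) / 4) * 2 ^ h * (4 / (6.5 * (h + 4))) * θ) := by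
        rw [hk, pow_succ]; ring
      rw [this]
      linarith
    · rw [hk]
      have h6 : (16 : ℝ) ≤ 2 * h + i := by exact_mod_cast hrh
      linarith
  have hθ0 : 0 ≤ θ := by linarith
  have e1 : (2 : ℝ) ^ (-(h : ℝ) / 4) * θ * Q * q ^ 2 * N / (6.5 * (1 / 2 ^ k) * L * N)
      = (2 : ℝ) ^ (-(h : ℝ) / 4) * 2 ^ k * θ * Q * (q ^ 2 / (6.5 * L)) := by
    field_simp
  rw [e1]
  have h7 : 4 / (6.5 * ((h : ℝ) + 4)) ≤ q ^ 2 / (6.5 * L) := by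
    rw [div_le_div_iff₀ (by positivity) (by positivity)]
    nlinarith
  have h8 : (2 : ℝ) ^ (-(h : ℝ) / 4) * 2 ^ k * θ * Q * (4 / (6.5 * ((h : ℝ) + 4)))
      ≤ (2 : ℝ) ^ (-(h : ℝ) / 4) * 2 ^ k * θ * Q * (q ^ 2 / (6.5 * L)) := by
    gcongr
  have h9 := mul_le_mul_of_nonneg_right hc (by linarith : 0 ≤ Q)
  have h10 : 0 ≤ ((i : ℝ) + h - 4) * (Q - 34) :=
    mul_nonneg (by linarith) (by linarith)
  linarith

/-- At the cap the exponent is only linear in the threshold, but that contains `2 ^ (i/3 + r/2)`,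
which grows exponentially in `n` and dominates `L`, `log n`, `i` and `h`. -/
theorem exponent_le_capped {δ : ℝ} (hδ : 0 < δ) {b n h i r L : ℕ} (h16 : 16 ≤ n) (hh4 : 4 ≤ h)
    (hh : 2 * h ≤ r + 2) (hri : n ≤ r + 1 + i) (hrn : r ≤ n) (hin : 2 * i ≤ n) (hL : 0 < L)
    (hLq : (L : ℝ) ≤ ((h : ℝ) + 4) / 4 * (2 * Ctilde b)) (hq1 : 1 ≤ 2 * Ctilde b)
    (hδx : 8.65 ≤ δ * Real.log n) (hll : Real.log n - 0.38 ≤ Real.log (Real.log (2 ^ n))) :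
    (1 + 4 * δ) * Real.log n + 1.4 * (i + h) + 2.4 ≤ 15 / 32 * threshold δ b n r i h / L := by
  have hn16 : (16 : ℝ) ≤ n := by exact_mod_cast h16
  have hL' : (0 : ℝ) < L := by exact_mod_cast hL
  have hcap := le_two_rpow_capped h16 hh4 hh hri
  have hsq : Real.sqrt (2 ^ r * Real.log (Real.log (2 ^ n)))
      = (2 : ℝ) ^ ((r : ℝ) / 2) * Real.sqrt (Real.log (Real.log (2 ^ n))) := by
    rw [Real.sqrt_mul (by positivity)]
    congr 1
    rw [Real.sqrt_eq_rpow, ← Real.rpow_natCast_mul zero_le_two]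
    congr 1
    ring
  set u : ℝ := 0.11 * ((n : ℝ) - 16) with hu
  have hu0' : 0 ≤ u := by rw [hu]; linarith
  have hx : Real.log n ≤ 2.78 + 0.0625 * ((n : ℝ) - 16) := by
    have h1 : Real.log n = Real.log (2 ^ 4) + Real.log (n / 16) := by
      rw [← Real.log_mul (by norm_num) (by positivity)]
      congr 1
      ring
    have h2 := Real.log_le_sub_one_of_pos (x := (n : ℝ) / 16) (by linarith)
    rw [Real.log_pow] at h1
    have := Real.log_two_lt_d9
    push_cast at h1
    linarith
  have hxlo : 2.7 ≤ Real.log n := by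
    have h1 : Real.log (2 ^ 4) ≤ Real.log n :=
      Real.log_le_log (by norm_num) (by linarith)
    rw [Real.log_pow] at h1
    have := Real.log_two_gt_d9
    push_cast at h1
    linarith
  set S := Real.sqrt (Real.log (Real.log (2 ^ n))) with hS
  have hS15 : 1.5 ≤ S := Real.le_sqrt_of_sq_le (by linarith)
  have hSx : Real.log n ≤ 2 * (S * (1 + u)) := by
    have : Real.log n ≤ 3 * (1 + u) := by rw [hu]; linarith
    nlinarith
  have hmain : (1 + 4 * δ) * Real.log n + 1.4 * (i + h) + 2.4
      ≤ 15 / 32 * (45 / 2 * (1 + u) ^ 2) * ((1 + 2 * δ) * S) := by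
    have h1 : 5.2 * ((1 + u) * ((1 + 2 * δ) * Real.log n))
        ≤ 15 / 32 * (45 / 2 * (1 + u) ^ 2) * ((1 + 2 * δ) * S) := by
      have := mul_le_mul_of_nonneg_left hSx
        (by positivity : 0 ≤ 5.2 * ((1 + u) * (1 + 2 * δ)))
      have h0 : 0 ≤ (1 + u) ^ 2 * ((1 + 2 * δ) * S) := by positivity
      linarith
    have h2 : 20 ≤ (1 + 2 * δ) * Real.log n := by linarith
    have h3 : (i : ℝ) + h ≤ n + 1 := by exact_mod_cast (by lia : i + h ≤ n + 1)
    have h4 : 0 ≤ u * ((1 + 2 * δ) * Real.log n - 20) := by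
      apply mul_nonneg hu0'; linarith
    have h5 : (n : ℝ) ≤ 16 + 10 * u := by rw [hu]; linarith
    linarith
  rw [le_div_iff₀ hL', threshold, hsq]
  have hE0 : 0 ≤ 15 / 32 * (45 / 2 * (1 + u) ^ 2) * ((1 + 2 * δ) * S) := by positivity
  refine (mul_le_mul hmain hLq hL'.le hE0).trans ?_
  calc _ = 15 / 32 * ((45 / 8 * ((h : ℝ) + 4) * (1 + u) ^ 2)
        * ((1 + 2 * δ) * (2 * Ctilde b) * S)) := by ring
    _ ≤ 15 / 32 * (((2 : ℝ) ^ (-(h : ℝ) / 8) * (2 : ℝ) ^ ((i : ℝ) / 3) * (2 : ℝ) ^ ((r : ℝ) / 2))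
        * ((1 + 2 * δ) * (2 * Ctilde b) * S)) := by gcongr
    _ = _ := by ring

/-! ### Tail bounds and the measure of the exceptional set -/

/-- The tail bound for the deviation over one block and one dyadic interval. -/
theorem volume_threshold_le_F_le {δ : ℝ} (hδ : 0 < δ) {n b r i h k a : ℕ} (M : ℕ)
    (hn : Real.exp (6 / (δ * Real.log 2)) < n) (hb : 2 ≤ b) (hri : n ≤ r + 1 + i) (hrn : r ≤ n)
    (hin : 2 * i ≤ n) (hh : 2 * h ≤ r + 2) (hk : k = h + 1 ∨ k = h ∧ r + 1 ≤ 2 * h)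
    (ha : a < 2 ^ k) :
    volume {x | x ∈ Ioo (0 : ℝ) 1 ∧ threshold δ b n r i h ≤
        F M (2 ^ r) ((a : ℝ) / 2 ^ k) (((a : ℝ) + 1) / 2 ^ k) (orbit b x)}
      ≤ ENNReal.ofReal ((n : ℝ) ^ (-1 - 4 * δ) * (1 / 4) ^ i * (1 / 2) ^ (2 * h + 1)) := by
  have hn2 : 2 ≤ n := two_le_of_exp_lt hδ hn
  have hδx := le_mul_log_of_exp_lt hδ hn
  have hll := log_sub_le_log_log (by lia : 1 ≤ n)
  have hx2 : 0.693 ≤ Real.log n := by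
    have h1 := Real.log_two_gt_d9
    have h2 : Real.log 2 ≤ Real.log n := Real.log_le_log two_pos (by exact_mod_cast hn2)
    linarith
  obtain ⟨hQA, hQ⟩ := exponent_facts hδ hx2 hδx hll
  have hl : 0 < Real.log (Real.log (2 ^ n)) := by linarith
  have hθ := sq_two_rpow_third i
  have hu0 : 0 ≤ (a : ℝ) / 2 ^ k := by positivity
  have hv1 : ((a : ℝ) + 1) / 2 ^ k ≤ 1 := by
    rw [div_le_one (by positivity)]; exact_mod_cast ha
  have hlen : ((a : ℝ) + 1) / 2 ^ k - (a : ℝ) / 2 ^ k = 1 / 2 ^ k := by ring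
  have huv : (a : ℝ) / 2 ^ k ≤ ((a : ℝ) + 1) / 2 ^ k := by
    have : (0 : ℝ) < 1 / 2 ^ k := by positivity
    linarith
  have hRpos : 0 < threshold δ b n r i h := threshold_pos hδ hb hl
  have hoeff : ∀ c : ℝ, c ≤ 2 * (2 : ℝ) ^ (-(h : ℝ) / 4) →
      (1 + 4 * δ) * Real.log n + 1.4 * (i + h) + 2.4 ≤
        c * ((2 : ℝ) ^ ((i : ℝ) / 3)) ^ 2 * ((1 + 2 * δ) ^ 2 * Real.log (Real.log (2 ^ n))) →
      volume {x | x ∈ Ioo (0 : ℝ) 1 ∧ threshold δ b n r i h ≤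
        F M (2 ^ r) ((a : ℝ) / 2 ^ k) (((a : ℝ) + 1) / 2 ^ k) (orbit b x)}
      ≤ ENNReal.ofReal ((n : ℝ) ^ (-1 - 4 * δ) * (1 / 4) ^ i * (1 / 2) ^ (2 * h + 1)) := by
    intro c hc hE
    exact (volume_le_F_hoeffding hb hu0 hv1 huv M (by positivity) hRpos).trans
      (ENNReal.ofReal_le_ofReal (two_mul_exp_le_of_le (by lia)
        (hE.trans (hoeffding_exponent hδ hb hl hc))))
  rcases le_or_gt h 3 with h3 | h3
  -- For `h ≤ 3` the Hoeffding constant `2 * 2 ^ (-h/4)` is at least `2 * 2 ^ (-3/4) > 1.18`.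
  · refine hoeff 1.18 ?_ (exponent_le_of_le_three h3 hQA hQ hθ)
    have h4 : (0.59 : ℝ) ≤ 2 ^ (-(3 : ℝ) / 4) := by
      refine le_of_pow_le_pow_left₀ four_ne_zero (by positivity) ?_
      rw [← Real.rpow_mul_natCast zero_le_two]
      norm_num
    have h5 : (2 : ℝ) ^ (-(3 : ℝ) / 4) ≤ 2 ^ (-(h : ℝ) / 4) := by
      refine Real.rpow_le_rpow_of_exponent_le one_le_two ?_
      have : (h : ℝ) ≤ 3 := by exact_mod_cast h3
      linarith
    linarith
  rcases le_or_gt n 15 with h15 | h15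
  -- Here `2h ≤ r + 2 ≤ 17` gives `h ≤ 8`, whence `0.5`; also `h ≥ 4` forces `n ≥ 6`. So small an
  -- `n` is possible only for `δ` above `3.1`, which compensates for the weak constant.
  · refine hoeff 0.5 ?_ (exponent_le_of_le_fifteen hδ (by lia) h15 (by lia) hδx hQ
      (mul_le_mul_of_nonneg_left hll (sq_nonneg _)) hθ)
    have h5 : (2 : ℝ) ^ (-(2 : ℝ)) ≤ 2 ^ (-(h : ℝ) / 4) := by
      refine Real.rpow_le_rpow_of_exponent_le one_le_two ?_
      have : (h : ℝ) ≤ 8 := by exact_mod_cast (by lia : h ≤ 8)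
      linarith
    rw [Real.rpow_neg zero_le_two] at h5
    norm_num at h5 ⊢
    linarith
  -- This choice makes `b ^ L` at least the reciprocal `2 ^ k` of the interval length, and at least
  -- `32` as `h ≥ 4`: the two requirements of the Bernstein bound.
  · set L := Nat.clog b (2 ^ (h + 1))
    have hpow : 2 ^ (h + 1) ≤ b ^ L := Nat.le_pow_clog hb _
    have hB : 32 ≤ b ^ L := le_trans (by
      calc 32 = 2 ^ 5 := by norm_num
        _ ≤ 2 ^ (h + 1) := Nat.pow_le_pow_right two_pos (by lia)) hpow
    have hkpow : (2 : ℝ) ^ k ≤ (b : ℝ) ^ L := by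
      have : 2 ^ k ≤ b ^ L :=
        (Nat.pow_le_pow_right two_pos (by rcases hk with hk | hk <;> lia)).trans hpow
      exact_mod_cast this
    have hLpos : 0 < L := by
      rcases Nat.eq_zero_or_pos L with h0 | h0
      · rw [h0] at hB; simp at hB
      · exact h0
    have hL' : (0 : ℝ) < L := by exact_mod_cast hLpos
    have hLq : (L : ℝ) ≤ ((h : ℝ) + 4) / 4 * (2 * Ctilde b) := clog_le_mul_Ctilde hb h
    have hq1 := one_le_two_mul_Ctilde hb
    have hE1 : (1 + 4 * δ) * Real.log n + 1.4 * (i + h) + 2.4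
        ≤ threshold δ b n r i h ^ 2 / (6.5 * (1 / 2 ^ k) * L * (2 ^ r : ℕ)) := by
      rw [threshold_sq hl.le]
      push_cast
      exact exponent_le_uncapped hQA hQ hθ h3 (hk.imp_right fun hk => ⟨hk.1, by lia⟩) hLpos hLq hq1
        (by positivity)
    have hE2 := exponent_le_capped hδ h15 h3 hh hri hrn hin hLpos hLq hq1 hδx hll
    obtain ⟨t, ht0, htL, htE⟩ := exists_bernstein_parameter (p := 1 / 2 ^ k) (by positivity) hL'
      (by positivity : (0 : ℝ) < (2 ^ r : ℕ)) hRpos hE1 hE2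
    have := volume_le_F_bernstein hb hB hu0 hv1
      (by rw [hlen, one_div_mul_eq_div, le_div_iff₀ (by positivity), one_mul]; exact hkpow)
      M (2 ^ r) (threshold δ b n r i h) ht0 htL
    rw [hlen] at this
    refine this.trans (ENNReal.ofReal_le_ofReal
      (le_trans ?_ (two_mul_exp_le_of_le (by lia) le_rfl)))
    refine mul_le_mul_of_nonneg_left (Real.exp_le_exp.2 ?_) zero_le_two
    linarith

theorem T_two_pow (r : ℕ) : T (2 ^ r) = r / 2 + 1 := by
  have hl := Real.log_pos one_lt_two
  have h4 : Real.log 4 = 2 * Real.log 2 := by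
    rw [show (4 : ℝ) = 2 ^ 2 by norm_num, Real.log_pow]; norm_num
  rw [T, h4]
  push_cast
  rw [Real.log_pow, mul_div_mul_right _ _ hl.ne', Nat.floor_div_ofNat, Nat.floor_natCast]

theorem level_eq {r h : ℕ} (hh : h ≤ T (2 ^ r)) :
    level (T (2 ^ r)) h = h + 1 ∨ level (T (2 ^ r)) h = h ∧ r + 1 ≤ 2 * h := by
  rw [T_two_pow] at hh ⊢
  rw [level]
  split_ifs with h1
  · exact Or.inl rfl
  · exact Or.inr ⟨by lia, by lia⟩

theorem threshold_G (δ : ℝ) (b n h : ℕ) :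
    (2 : ℝ) ^ (-(h : ℝ) / 8) * phi δ b (2 ^ n) = threshold δ b n n 0 h := by
  rw [phi, threshold]
  push_cast
  rw [zero_div, Real.rpow_zero]
  ring

/-- In powers of two, `(l - n - 3) / 6 + n / 2 = (n - l) / 3 + (l - 1) / 2`: relative to the square
root of the block length, the threshold grows by `2 ^ (i/3)`. That growth pays for the `2 ^ i`
starting points. -/
theorem threshold_H (δ : ℝ) (b : ℕ) {n l : ℕ} (hl : 1 ≤ l) (hln : l ≤ n) (h : ℕ) :
    (2 : ℝ) ^ (-(h : ℝ) / 8) * (2 : ℝ) ^ (((l : ℝ) - (n : ℝ) - 3) / 6) * phi δ b (2 ^ n)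
      = threshold δ b n (l - 1) (n - l) h := by
  have hs : ∀ m : ℕ, Real.sqrt (2 ^ m * Real.log (Real.log (2 ^ n)))
      = (2 : ℝ) ^ ((m : ℝ) / 2) * Real.sqrt (Real.log (Real.log (2 ^ n))) := by
    intro m
    rw [Real.sqrt_mul (by positivity)]
    congr 1
    rw [Real.sqrt_eq_rpow, ← Real.rpow_natCast_mul zero_le_two]
    congr 1
    ring
  rw [phi, threshold]
  push_cast
  rw [hs, hs]
  have : (2 : ℝ) ^ (((l : ℝ) - (n : ℝ) - 3) / 6) * (2 : ℝ) ^ ((n : ℝ) / 2)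
      = (2 : ℝ) ^ (((n - l : ℕ) : ℝ) / 3) * (2 : ℝ) ^ (((l - 1 : ℕ) : ℝ) / 2) := by
    rw [← Real.rpow_add two_pos, ← Real.rpow_add two_pos, Nat.cast_sub hl, Nat.cast_sub hln]
    congr 1
    push_cast
    ring
  linear_combination ((2 : ℝ) ^ (-(h : ℝ) / 8) * (2 * (1 + 2 * δ) * Ctilde b)
    * Real.sqrt (Real.log (Real.log (2 ^ n)))) * this

/-- The points for which the deviation over the block of length `2 ^ r` starting at `M` reaches the
threshold for some dyadic interval. -/
def blockSet (δ : ℝ) (b n r i M : ℕ) : Set ℝ :=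
  {x | ∃ h a : ℕ, 1 ≤ h ∧ h ≤ T (2 ^ r) ∧ a < 2 ^ level (T (2 ^ r)) h ∧
    x ∈ Ioo (0 : ℝ) 1 ∧ threshold δ b n r i h ≤
      F M (2 ^ r) ((a : ℝ) / 2 ^ level (T (2 ^ r)) h) (((a : ℝ) + 1) / 2 ^ level (T (2 ^ r)) h)
        (orbit b x)}

/-- Union bound: at most `2 ^ (h + 1)` intervals, each costing `2 ^ (-2h-1)`, leave `2 ^ (-h)`, and
these sum to at most `1` over `h ≥ 1`. -/
theorem volume_blockSet_le {δ : ℝ} (hδ : 0 < δ) {n b r i : ℕ} (M : ℕ)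
    (hn : Real.exp (6 / (δ * Real.log 2)) < n) (hb : 2 ≤ b) (hri : n ≤ r + 1 + i) (hrn : r ≤ n)
    (hin : 2 * i ≤ n) :
    volume (blockSet δ b n r i M) ≤ ENNReal.ofReal ((n : ℝ) ^ (-1 - 4 * δ) * (1 / 4) ^ i) := by
  set c : ℝ := (n : ℝ) ^ (-1 - 4 * δ) * (1 / 4) ^ i with hc
  have hc0 : 0 ≤ c := by positivity
  have hsub : blockSet δ b n r i M ⊆ ⋃ h ∈ Finset.Icc 1 (T (2 ^ r)),
      ⋃ a ∈ Finset.range (2 ^ level (T (2 ^ r)) h),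
        {x | x ∈ Ioo (0 : ℝ) 1 ∧ threshold δ b n r i h ≤
          F M (2 ^ r) ((a : ℝ) / 2 ^ level (T (2 ^ r)) h)
            (((a : ℝ) + 1) / 2 ^ level (T (2 ^ r)) h) (orbit b x)} := by
    rintro x ⟨h, a, h1, h2, h3, h4⟩
    simp only [mem_iUnion]
    exact ⟨h, Finset.mem_Icc.2 ⟨h1, h2⟩, a, Finset.mem_range.2 h3, h4⟩
  have hgeom : ∀ t : ℕ, ∑ h ∈ Finset.Icc 1 t, ((1 : ℝ) / 2) ^ h = 1 - (1 / 2) ^ t := by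
    intro t
    induction t with
    | zero => simp
    | succ t ih => rw [Finset.sum_Icc_succ_top (by lia), ih]; ring
  calc volume (blockSet δ b n r i M)
      ≤ ∑ h ∈ Finset.Icc 1 (T (2 ^ r)), ∑ a ∈ Finset.range (2 ^ level (T (2 ^ r)) h),
          ENNReal.ofReal (c * (1 / 2) ^ (2 * h + 1)) := by
        refine (measure_mono hsub).trans ((measure_biUnion_finset_le _ _).trans ?_)
        refine Finset.sum_le_sum fun h hh => ?_
        refine (measure_biUnion_finset_le _ _).trans (Finset.sum_le_sum fun a ha => ?_)
        have hh' := (Finset.mem_Icc.1 hh).2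
        exact volume_threshold_le_F_le hδ M hn hb hri hrn hin (by rw [T_two_pow] at hh'; lia)
          (level_eq hh') (Finset.mem_range.1 ha)
    _ ≤ ∑ h ∈ Finset.Icc 1 (T (2 ^ r)), ENNReal.ofReal (c * (1 / 2) ^ h) := by
        refine Finset.sum_le_sum fun h hh => ?_
        rw [Finset.sum_const, Finset.card_range, nsmul_eq_mul, ← ENNReal.ofReal_natCast,
          ← ENNReal.ofReal_mul (by positivity)]
        refine ENNReal.ofReal_le_ofReal ?_
        have hk : (2 : ℝ) ^ level (T (2 ^ r)) h ≤ 2 ^ (h + 1) := by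
          refine pow_le_pow_right₀ one_le_two ?_
          rcases level_eq (Finset.mem_Icc.1 hh).2 with h1 | h1 <;> lia
        have e : (2 : ℝ) ^ (h + 1) * (1 / 2) ^ (2 * h + 1) = (1 / 2) ^ h := by
          rw [show 2 * h + 1 = (h + 1) + h by ring, pow_add (1 / 2 : ℝ) (h + 1) h, ← mul_assoc,
            ← mul_pow]
          norm_num
        push_cast
        calc (2 : ℝ) ^ level (T (2 ^ r)) h * (c * (1 / 2) ^ (2 * h + 1))
            ≤ 2 ^ (h + 1) * (c * (1 / 2) ^ (2 * h + 1)) := by gcongr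
          _ = c * (2 ^ (h + 1) * (1 / 2) ^ (2 * h + 1)) := by ring
          _ = _ := by rw [e]
    _ ≤ ENNReal.ofReal c := by
        rw [← ENNReal.ofReal_sum_of_nonneg fun h _ => by positivity, ← Finset.mul_sum, hgeom]
        refine ENNReal.ofReal_le_ofReal (mul_le_of_le_one_right hc0 ?_)
        have : (0 : ℝ) ≤ (1 / 2) ^ T (2 ^ r) := by positivity
        linarith

theorem GUnion_eq (δ : ℝ) (b n : ℕ) : GUnion δ b n = blockSet δ b n n 0 0 := by
  ext x
  simp only [GUnion, GSet, blockSet, mem_ofPred_eq, threshold_G]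

theorem HUnion_subset (δ : ℝ) (b n : ℕ) :
    HUnion δ b n ⊆ ⋃ i ∈ (Finset.range n).filter (2 * · ≤ n), ⋃ m ∈ Finset.Icc 1 (2 ^ i),
      blockSet δ b n (n - i - 1) i (2 ^ n + m * 2 ^ (n - i)) := by
  rintro x ⟨l, m, h, a, hl, hnl, hln, hm, hm', hh, hh', ha, hx, hF⟩
  have hnl' : n ≤ 2 * l := by
    have : (n : ℝ) ≤ 2 * l := by linarith
    exact_mod_cast this
  rw [threshold_H δ b hl hln] at hF
  simp only [mem_iUnion]
  refine ⟨n - l, by simp; lia, m, Finset.mem_Icc.2 ⟨hm, hm'⟩, ?_⟩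
  rw [Nat.sub_sub_self hln]
  exact ⟨h, a, hh, hh', ha, hx, hF⟩

theorem volume_GUnion_le {δ : ℝ} (hδ : 0 < δ) {n b : ℕ}
    (hn : Real.exp (6 / (δ * Real.log 2)) < n) (hb : 2 ≤ b) :
    volume (GUnion δ b n) ≤ ENNReal.ofReal ((n : ℝ) ^ (-1 - 4 * δ)) := by
  rw [GUnion_eq]
  simpa using volume_blockSet_le hδ (i := 0) 0 hn hb (by lia) le_rfl (by lia)

/-- For `i = n - l` there are `2 ^ i` starting points, each costing `4 ^ (-i)`; the sum of `2 ^
(-i)` is at most `2`. -/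
theorem volume_HUnion_le {δ : ℝ} (hδ : 0 < δ) {n b : ℕ}
    (hn : Real.exp (6 / (δ * Real.log 2)) < n) (hb : 2 ≤ b) :
    volume (HUnion δ b n) ≤ ENNReal.ofReal (2 * (n : ℝ) ^ (-1 - 3 * δ)) := by
  set c : ℝ := (n : ℝ) ^ (-1 - 4 * δ) with hc
  have hn2 := two_le_of_exp_lt hδ hn
  have hc0 : 0 ≤ c := by positivity
  calc volume (HUnion δ b n)
      ≤ ∑ i ∈ (Finset.range n).filter (2 * · ≤ n), ∑ m ∈ Finset.Icc 1 (2 ^ i),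
          ENNReal.ofReal (c * (1 / 4) ^ i) := by
        refine (measure_mono (HUnion_subset δ b n)).trans
          ((measure_biUnion_finset_le _ _).trans ?_)
        refine Finset.sum_le_sum fun i hi => ?_
        simp only [Finset.mem_filter, Finset.mem_range] at hi
        refine (measure_biUnion_finset_le _ _).trans (Finset.sum_le_sum fun m _ => ?_)
        exact volume_blockSet_le hδ _ hn hb (by lia) (by lia) hi.2
    _ ≤ ∑ i ∈ Finset.range n, ENNReal.ofReal (c * (1 / 2) ^ i) := by
        refine (Finset.sum_le_sum_of_subset (Finset.filter_subset _ _)).trans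
          (Finset.sum_le_sum fun i _ => ?_)
        rw [Finset.sum_const, Nat.card_Icc, nsmul_eq_mul, ← ENNReal.ofReal_natCast,
          ← ENNReal.ofReal_mul (by positivity)]
        refine ENNReal.ofReal_le_ofReal (le_of_eq ?_)
        push_cast [Nat.add_sub_cancel]
        rw [mul_left_comm, ← mul_pow]
        norm_num
    _ ≤ _ := by
        rw [← ENNReal.ofReal_sum_of_nonneg fun i _ => by positivity, ← Finset.mul_sum]
        refine ENNReal.ofReal_le_ofReal ?_
        rw [mul_comm]
        refine mul_le_mul ?_ ?_ hc0 zero_le_two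
        · exact (summable_geometric_two.sum_le_tsum _ fun _ _ => by positivity).trans_eq
            tsum_geometric_two
        · exact Real.rpow_le_rpow_of_exponent_le (by exact_mod_cast (by lia : 1 ≤ n)) (by linarith)

theorem summable_rpow_bound {δ : ℝ} (hδ : 0 < δ) :
    Summable fun n : ℕ => (n : ℝ) ^ (-1 - 4 * δ) + 2 * (n : ℝ) ^ (-1 - 3 * δ) :=
  (Real.summable_nat_rpow.2 (by linarith)).add
    ((Real.summable_nat_rpow.2 (by linarith)).mul_left 2)

theorem volume_exceptional_le {δ : ℝ} (hδ : 0 < δ) {n₀ b : ℕ}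
    (hn₀ : Real.exp (6 / (δ * Real.log 2)) < n₀) (hb : 2 ≤ b) :
    volume (exceptional δ b n₀) ≤ ENNReal.ofReal (∑' k : ℕ,
      (((k + n₀ : ℕ) : ℝ) ^ (-1 - 4 * δ) + 2 * ((k + n₀ : ℕ) : ℝ) ^ (-1 - 3 * δ))) := by
  have hsub : exceptional δ b n₀ ⊆ ⋃ k : ℕ, (GUnion δ b (k + n₀) ∪ HUnion δ b (k + n₀)) := by
    intro x hx
    simp only [exceptional, mem_iUnion] at hx ⊢
    obtain ⟨n, hn, hx⟩ := hx
    exact ⟨n - n₀, by rwa [Nat.sub_add_cancel hn]⟩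
  refine (measure_mono hsub).trans ((measure_iUnion_le _).trans ?_)
  rw [ENNReal.ofReal_tsum_of_nonneg (fun k => by positivity)
    ((summable_nat_add_iff n₀).2 (summable_rpow_bound hδ))]
  refine ENNReal.tsum_le_tsum fun k => ?_
  have hk : Real.exp (6 / (δ * Real.log 2)) < (k + n₀ : ℕ) :=
    hn₀.trans_le (by exact_mod_cast Nat.le_add_left n₀ k)
  rw [ENNReal.ofReal_add (by positivity) (by positivity)]
  exact (measure_union_le _ _).trans (add_le_add (volume_GUnion_le hδ hk hb)
    (volume_HUnion_le hδ hk hb))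

/-- The exceptional set is bounded by the tail of a convergent series in which `b` does not occur,
so `n₀` is uniform in `b`. -/
theorem exists_volume_exceptional_lt {η δ : ℝ} (hη : 0 < η) (hδ : 0 < δ) :
    ∃ n₀ : ℕ, ∀ b : ℕ, 2 ≤ b → volume (exceptional δ b n₀) < ENNReal.ofReal η := by
  have h1 := tendsto_sum_nat_add fun n : ℕ =>
    (n : ℝ) ^ (-1 - 4 * δ) + 2 * (n : ℝ) ^ (-1 - 3 * δ)
  have h2 := tendsto_natCast_atTop_atTop (R := ℝ) |>.eventually_gt_atTop
    (Real.exp (6 / (δ * Real.log 2)))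
  obtain ⟨n₀, h3, h4⟩ := ((h1.eventually_lt_const hη).and h2).exists
  exact ⟨n₀, fun b hb => (volume_exceptional_le hδ h4 hb).trans_lt
    ((ENNReal.ofReal_lt_ofReal_iff hη).2 h3)⟩

/-! ### Deterministic chaining over dyadic intervals -/

/-- A dyadic rational of level `k ≤ t` is joined to a multiple of `1/4` along dyadic intervals of
levels at least `3`, using no two consecutive levels. -/
theorem exists_quarter_near {D : ℝ → ℝ} {X σ : ℝ} {t : ℕ} (hX : 0 ≤ X) (hσ0 : 0 < σ) (hσ1 : σ < 1)
    (hD : ∀ h a : ℕ, 1 ≤ h → h < t → a < 2 ^ (h + 1) →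
      |D (((a : ℝ) + 1) / 2 ^ (h + 1)) - D ((a : ℝ) / 2 ^ (h + 1))| ≤ σ ^ h * X) :
    ∀ k a : ℕ, k + 1 ≤ t → a ≤ 2 ^ (k + 1) → ∃ c : ℕ, c ≤ 4 ∧
      |D ((a : ℝ) / 2 ^ (k + 1)) - D ((c : ℝ) / 4)| ≤ (σ ^ 2 - σ ^ (k + 2)) / (1 - σ ^ 2) * X := by
  have h1σ : 0 < 1 - σ ^ 2 := by nlinarith
  have hmono : ∀ k : ℕ, (σ ^ 2 - σ ^ (k + 2)) / (1 - σ ^ 2) * X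
      ≤ (σ ^ 2 - σ ^ (k + 1 + 2)) / (1 - σ ^ 2) * X := by
    intro k
    have : σ ^ (k + 1 + 2) ≤ σ ^ (k + 2) := pow_le_pow_of_le_one hσ0.le hσ1.le (by lia)
    gcongr
  intro k
  induction k using Nat.strong_induction_on with
  | _ k ih =>
    intro a hk ha
    match k, ih, hk, ha with
    | 0, _, _, ha =>
      refine ⟨2 * a, by lia, ?_⟩
      have : ((2 * a : ℕ) : ℝ) / 4 = (a : ℝ) / 2 ^ (0 + 1) := by push_cast; ring
      rw [this]
      simp
    | 1, _, _, ha =>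
      refine ⟨a, by lia, ?_⟩
      have := hmono 0
      simp only [zero_add, sub_self, zero_div, zero_mul] at this
      norm_num at this ⊢
      exact this
    | k + 2, ih, hk, ha =>
      rcases Nat.even_or_odd' a with ⟨d, rfl | rfl⟩
      · obtain ⟨c, hc, h⟩ := ih (k + 1) (by lia) d (by lia) (by rw [pow_succ] at ha; lia)
        refine ⟨c, hc, ?_⟩
        have e : ((2 * d : ℕ) : ℝ) / 2 ^ (k + 2 + 1) = (d : ℝ) / 2 ^ (k + 1 + 1) := by
          push_cast; rw [pow_succ]; field_simp
        rw [e]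
        exact h.trans (hmono (k + 1))
      -- An odd numerator has a neighbour divisible by `4`, whose point lies two levels lower; one
      -- dyadic interval bridges the gap. Hence the cost is a geometric series in `σ ^ 2` rather
      -- than in `σ`.
      · have hstep : ∀ d' : ℕ, d' ≤ 2 ^ (k + 1) →
            |D (((2 * d + 1 : ℕ) : ℝ) / 2 ^ (k + 2 + 1)) - D ((d' : ℝ) / 2 ^ (k + 1))|
              ≤ σ ^ (k + 2) * X →
            ∃ c : ℕ, c ≤ 4 ∧ |D (((2 * d + 1 : ℕ) : ℝ) / 2 ^ (k + 2 + 1)) - D ((c : ℝ) / 4)|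
              ≤ (σ ^ 2 - σ ^ (k + 2 + 2)) / (1 - σ ^ 2) * X := by
          intro d' hd' hle
          obtain ⟨c, hc, h⟩ := ih k (by lia) d' (by lia) hd'
          refine ⟨c, hc, (abs_sub_le _ _ _).trans ((add_le_add hle h).trans_eq ?_)⟩
          field_simp
          ring
        have hpow : 2 ^ (k + 2 + 1) = 4 * 2 ^ (k + 1) := by ring
        rcases Nat.even_or_odd' d with ⟨f, rfl | rfl⟩
        · refine hstep f (by lia) ?_
          have := hD (k + 2) (4 * f) (by lia) (by lia) (by lia)
          have e : ((4 * f : ℕ) : ℝ) / 2 ^ (k + 2 + 1) = (f : ℝ) / 2 ^ (k + 1) := by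
            push_cast; rw [show k + 2 + 1 = (k + 1) + 2 by ring, pow_add]; field_simp; ring
          rw [e] at this
          convert this using 4
          push_cast
          ring
        · refine hstep (f + 1) (by lia) ?_
          have := hD (k + 2) (4 * f + 3) (by lia) (by lia) (by lia)
          have e : (((4 * f + 3 : ℕ) : ℝ) + 1) / 2 ^ (k + 2 + 1) = ((f + 1 : ℕ) : ℝ) / 2 ^ (k + 1) := by
            push_cast; rw [show k + 2 + 1 = (k + 1) + 2 by ring, pow_add]; field_simp; ring
          rw [e, abs_sub_comm] at this
          convert this using 4
          push_cast
          ring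

/-- Since `D 0 = D 1`, the quarters lie on a circle, and any two of them are at most two steps
apart. -/
theorem abs_sub_quarters_le {D : ℝ → ℝ} {Y : ℝ} (h0 : D 0 = 0) (h1 : D 1 = 0)
    (hD : ∀ a : ℕ, a < 4 → |D (((a : ℝ) + 1) / 4) - D ((a : ℝ) / 4)| ≤ Y) {c d : ℕ}
    (hc : c ≤ 4) (hd : d ≤ 4) : |D ((c : ℝ) / 4) - D ((d : ℝ) / 4)| ≤ 2 * Y := by
  have e0 := abs_le.1 (hD 0 (by norm_num))
  have e1 := abs_le.1 (hD 1 (by norm_num))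
  have e2 := abs_le.1 (hD 2 (by norm_num))
  have e3 := abs_le.1 (hD 3 (by norm_num))
  norm_num [h0, h1] at e0 e1 e2 e3
  interval_cases c <;> interval_cases d <;> norm_num [h0, h1, abs_le] <;>
    first
    | linarith
    | (constructor <;> linarith)

/-- The bound for all intervals from the bounds for dyadic intervals. -/
theorem sub_le_of_dyadic {C D : ℝ → ℝ} {N X σ : ℝ} {t : ℕ} (ht : 2 ≤ t) (hC : Monotone C)
    (hDC : ∀ α, D α = C α - α * N) (hN : 0 ≤ N) (hX : 0 ≤ X) (hσ0 : 0 < σ) (hσ1 : σ < 1)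
    (h0 : D 0 = 0) (h1 : D 1 = 0)
    (hD : ∀ h a : ℕ, 1 ≤ h → h < t → a < 2 ^ (h + 1) →
      |D (((a : ℝ) + 1) / 2 ^ (h + 1)) - D ((a : ℝ) / 2 ^ (h + 1))| ≤ σ ^ h * X)
    {u v : ℝ} (hu : u ∈ Icc (0 : ℝ) 1) (hv : v ∈ Icc (0 : ℝ) 1) :
    D v - D u ≤ (2 * σ ^ 2 / (1 - σ ^ 2) + 2 * σ) * X + 2 * (N / 2 ^ t) := by
  have h1σ : 0 < 1 - σ ^ 2 := by nlinarith
  have hdy : ∀ a d : ℕ, a ≤ 2 ^ t → d ≤ 2 ^ t →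
      D ((a : ℝ) / 2 ^ t) - D ((d : ℝ) / 2 ^ t) ≤ (2 * σ ^ 2 / (1 - σ ^ 2) + 2 * σ) * X := by
    obtain ⟨k, rfl⟩ : ∃ k, t = k + 1 := ⟨t - 1, by lia⟩
    intro a d ha hd
    obtain ⟨c, hc, h2⟩ := exists_quarter_near hX hσ0 hσ1 hD k a le_rfl ha
    obtain ⟨c', hc', h3⟩ := exists_quarter_near hX hσ0 hσ1 hD k d le_rfl hd
    have h4 := abs_sub_quarters_le (Y := σ * X) h0 h1 (fun a ha => by
      have := hD 1 a le_rfl (by lia) (by simpa using ha)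
      norm_num at this
      exact this) hc hc'
    have h5 : (σ ^ 2 - σ ^ (k + 2)) / (1 - σ ^ 2) * X ≤ σ ^ 2 / (1 - σ ^ 2) * X := by
      have : 0 < σ ^ (k + 2) := by positivity
      gcongr
      linarith
    have e : (2 * σ ^ 2 / (1 - σ ^ 2) + 2 * σ) * X
        = 2 * (σ ^ 2 / (1 - σ ^ 2) * X) + 2 * (σ * X) := by ring
    rw [e]
    linarith [(abs_le.1 h2).2, (abs_le.1 h3).1, (abs_le.1 h4).2]
  -- Rounding to level `t` uses only that the count `C` is monotone; what changes is the linear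
  -- term, by at most `N / 2 ^ t` at each endpoint.
  have hlow : ∀ w ∈ Icc (0 : ℝ) 1, ∃ a : ℕ, a ≤ 2 ^ t ∧ D ((a : ℝ) / 2 ^ t) - N / 2 ^ t ≤ D w := by
    intro w hw
    have hp : (0 : ℝ) < 2 ^ t := by positivity
    refine ⟨⌊w * 2 ^ t⌋₊, ?_, ?_⟩
    · refine Nat.floor_le_of_le ?_
      push_cast
      nlinarith [hw.2]
    · have ha := Nat.floor_le (mul_nonneg hw.1 hp.le)
      have hb := Nat.lt_floor_add_one (w * 2 ^ t)
      set a := ⌊w * 2 ^ t⌋₊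
      have h2 : (a : ℝ) / 2 ^ t ≤ w := by rwa [div_le_iff₀ hp]
      have h3 : w ≤ ((a : ℝ) + 1) / 2 ^ t := by rw [le_div_iff₀ hp]; exact hb.le
      have h4 := hC h2
      have h5 := mul_le_mul_of_nonneg_right h3 hN
      rw [hDC, hDC]
      have e : ((a : ℝ) + 1) / 2 ^ t * N = (a : ℝ) / 2 ^ t * N + N / 2 ^ t := by ring
      linarith
  have hupp : ∀ w ∈ Icc (0 : ℝ) 1, ∃ a : ℕ, a ≤ 2 ^ t ∧ D w ≤ D ((a : ℝ) / 2 ^ t) + N / 2 ^ t := by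
    intro w hw
    have hp : (0 : ℝ) < 2 ^ t := by positivity
    refine ⟨⌈w * 2 ^ t⌉₊, ?_, ?_⟩
    · refine Nat.ceil_le.2 ?_
      push_cast
      nlinarith [hw.2]
    · have ha := Nat.le_ceil (w * 2 ^ t)
      have hb := Nat.ceil_lt_add_one (mul_nonneg hw.1 hp.le)
      set a := ⌈w * 2 ^ t⌉₊
      have h2 : w ≤ (a : ℝ) / 2 ^ t := by rwa [le_div_iff₀ hp]
      have h3 : (a : ℝ) / 2 ^ t ≤ w + 1 / 2 ^ t := by
        rw [div_le_iff₀ hp, add_mul, one_div_mul_cancel hp.ne']; exact hb.le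
      have h4 := hC h2
      have h5 := mul_le_mul_of_nonneg_right h3 hN
      rw [hDC, hDC]
      have e : (w + 1 / 2 ^ t) * N = w * N + N / 2 ^ t := by ring
      linarith
  obtain ⟨a, ha, ha'⟩ := hupp v hv
  obtain ⟨d, hd, hd'⟩ := hlow u hu
  linarith [hdy a d ha hd]

theorem visits_eq_sub (M N : ℕ) {u v : ℝ} (huv : u ≤ v) (y : ℕ → ℝ)
    (hy : ∀ j, y j ∈ Ico (0 : ℝ) 1) :
    (visits M N u v y : ℝ) = visits M N 0 v y - visits M N 0 u y := by
  rw [eq_sub_iff_add_eq]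
  unfold visits
  rw [← Nat.cast_add, ← Finset.card_union_of_disjoint]
  · congr 2
    ext j
    simp only [Finset.mem_union, Finset.mem_filter]
    have := (hy j).1
    constructor
    · rintro (⟨h1, h2, h3⟩ | ⟨h1, h2, h3⟩)
      · exact ⟨h1, this, h3⟩
      · exact ⟨h1, this, h3.trans_le huv⟩
    · rintro ⟨h1, h2, h3⟩
      rcases le_or_gt u (y j) with h | h
      · exact Or.inl ⟨h1, h, h3⟩
      · exact Or.inr ⟨h1, h2, h⟩
  · rw [Finset.disjoint_filter]
    rintro j _ ⟨h1, _⟩ ⟨_, h2⟩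
    linarith

theorem F_le_of_dyadic {M N t : ℕ} (ht : 2 ≤ t) {X σ : ℝ} (hX : 0 ≤ X) (hσ0 : 0 < σ) (hσ1 : σ < 1)
    {y : ℕ → ℝ} (hy : ∀ j, y j ∈ Ico (0 : ℝ) 1)
    (hF : ∀ h a : ℕ, 1 ≤ h → h < t → a < 2 ^ (h + 1) →
      F M N ((a : ℝ) / 2 ^ (h + 1)) (((a : ℝ) + 1) / 2 ^ (h + 1)) y ≤ σ ^ h * X)
    {u v : ℝ} (hu : 0 ≤ u) (huv : u ≤ v) (hv : v ≤ 1) :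
    F M N u v y ≤ (2 * σ ^ 2 / (1 - σ ^ 2) + 2 * σ) * X + 2 * ((N : ℝ) / 2 ^ t) := by
  set C : ℝ → ℝ := fun α => visits M N 0 α y with hC
  set D : ℝ → ℝ := fun α => C α - α * N with hD
  have hFD : ∀ u v, u ≤ v → F M N u v y = |D v - D u| := by
    intro u v huv
    rw [F, visits_eq_sub M N huv y hy]
    simp only [hD, hC]
    congr 1
    ring
  have hmono : Monotone C := by
    intro α β hαβ
    simp only [hC, visits, Nat.cast_le]
    refine Finset.card_le_card fun j hj => ?_
    simp only [Finset.mem_filter] at hj ⊢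
    exact ⟨hj.1, hj.2.1, hj.2.2.trans_le hαβ⟩
  have h0 : D 0 = 0 := by
    have : visits M N 0 0 y = 0 := by
      rw [visits, Finset.card_eq_zero, Finset.filter_eq_empty_iff]
      rintro j _ ⟨h1, h2⟩
      linarith
    simp [hD, hC, this]
  have h1 : D 1 = 0 := by
    have : visits M N 0 1 y = N := by
      rw [visits, Finset.filter_true_of_mem fun j _ => ⟨(hy j).1, (hy j).2⟩]
      simp
    simp [hD, hC, this]
  have hstep : ∀ h a : ℕ, 1 ≤ h → h < t → a < 2 ^ (h + 1) →
      |D (((a : ℝ) + 1) / 2 ^ (h + 1)) - D ((a : ℝ) / 2 ^ (h + 1))| ≤ σ ^ h * X := by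
    intro h a hh hht ha
    rw [← hFD _ _ (by gcongr; linarith)]
    exact hF h a hh hht ha
  rw [hFD u v huv, abs_le]
  have key := fun p q hp hq => sub_le_of_dyadic ht hmono (D := D) (fun _ => rfl)
    (Nat.cast_nonneg N) hX hσ0 hσ1 h0 h1 hstep (u := p) (v := q) hp hq
  have k1 := key u v ⟨hu, huv.trans hv⟩ ⟨hu.trans huv, hv⟩
  have k2 := key v u ⟨hu.trans huv, hv⟩ ⟨hu, huv.trans hv⟩
  constructor <;> linarith

theorem F_add_le (M N₁ N₂ : ℕ) (u v : ℝ) (y : ℕ → ℝ) :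
    F M (N₁ + N₂) u v y ≤ F M N₁ u v y + F (M + N₁) N₂ u v y := by
  have : visits M (N₁ + N₂) u v y = visits M N₁ u v y + visits (M + N₁) N₂ u v y := by
    unfold visits
    rw [← Finset.card_union_of_disjoint, ← Finset.filter_union,
      Finset.Ico_union_Ico_eq_Ico (by lia) (by lia), add_assoc]
    exact Finset.disjoint_filter_filter (Finset.Ico_disjoint_Ico_consecutive _ _ _)
  rw [F, this]
  refine le_trans (le_of_eq ?_) (abs_add_le _ _)
  congr 1
  push_cast
  ring

theorem dyadic_constant_le {σ : ℝ} (hσ : σ = (2 : ℝ) ^ (-(1 : ℝ) / 8)) :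
    0 < σ ∧ σ < 1 ∧ 2 * σ ^ 2 / (1 - σ ^ 2) + 2 * σ ≤ 12.42 := by
  have h0 : 0 < σ := by rw [hσ]; positivity
  have h8 : σ ^ 8 = 1 / 2 := by
    rw [hσ, ← Real.rpow_mul_natCast zero_le_two]
    norm_num
  have h1 : σ ≤ 0.9171 := by
    refine le_of_pow_le_pow_left₀ (n := 8) (by norm_num) (by norm_num) ?_
    rw [h8]; norm_num
  have h2 : σ ^ 2 ≤ 0.841 := by
    refine le_of_pow_le_pow_left₀ (n := 4) (by norm_num) (by norm_num) ?_
    rw [← pow_mul, h8]; norm_num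
  refine ⟨h0, by linarith, ?_⟩
  have h3 : 2 * σ ^ 2 / (1 - σ ^ 2) ≤ 10.58 := by
    rw [div_le_iff₀ (by linarith)]; linarith
  linarith

/-- The thresholds of successive shorter blocks decrease by the ratio `κ`. The longest one used,
with `l = n - 1`, carries `κ ^ 4`, which gives the sum `κ ^ 4 / (1 - κ)`. -/
theorem block_constant_le {κ : ℝ} (hκ : κ = (2 : ℝ) ^ (-(1 : ℝ) / 6)) :
    0 < κ ∧ κ < 1 ∧ κ ^ 4 / (1 - κ) ≤ 5.79 := by
  have h0 : 0 < κ := by rw [hκ]; positivity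
  have h6 : κ ^ 6 = 1 / 2 := by
    rw [hκ, ← Real.rpow_mul_natCast zero_le_two]
    norm_num
  have h1 : κ ≤ 0.891 := by
    refine le_of_pow_le_pow_left₀ (n := 6) (by norm_num) (by norm_num) ?_
    rw [h6]; norm_num
  have h2 : κ ^ 4 ≤ 0.63 := by
    refine le_of_pow_le_pow_left₀ (n := 3) (by norm_num) (by norm_num) ?_
    rw [← pow_mul, show 4 * 3 = 6 * 2 by norm_num, pow_mul, h6]; norm_num
  refine ⟨h0, by linarith, ?_⟩
  rw [div_le_iff₀ (by linarith)]
  linarith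

/-- Outside `blockSet`, the deviation over the block is controlled for all intervals. -/
theorem F_le_of_notMem_blockSet {δ : ℝ} {b n r i M : ℕ} (hr : 2 ≤ r) {x : ℝ}
    (hx : x ∈ Ioo (0 : ℝ) 1) (hxB : x ∉ blockSet δ b n r i M)
    (hthr : 0 ≤ threshold δ b n r i 0) {u v : ℝ} (hu : 0 ≤ u) (huv : u ≤ v) (hv : v ≤ 1) :
    F M (2 ^ r) u v (orbit b x) ≤ 12.42 * threshold δ b n r i 0 + 2 ^ ((r + 1) / 2) := by
  obtain ⟨hσ0, hσ1, hσ⟩ := dyadic_constant_le rfl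
  have ht : T (2 ^ r) = r / 2 + 1 := T_two_pow r
  have hthr' : ∀ h, threshold δ b n r i h
      = ((2 : ℝ) ^ (-(1 : ℝ) / 8)) ^ h * threshold δ b n r i 0 := by
    intro h
    have : (2 : ℝ) ^ (-(h : ℝ) / 8) = ((2 : ℝ) ^ (-(1 : ℝ) / 8)) ^ h := by
      rw [← Real.rpow_mul_natCast zero_le_two]
      congr 1
      ring
    simp only [threshold, this, Nat.cast_zero, neg_zero, zero_div, Real.rpow_zero]
    ring
  have key := F_le_of_dyadic (M := M) (N := 2 ^ r) (t := T (2 ^ r)) (by lia) hthr hσ0 hσ1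
    (orbit_mem_Ico b x) (fun h a hh hht ha => by
      rw [← hthr']
      by_contra hneg
      refine hxB ⟨h, a, hh, hht.le, ?_, hx, ?_⟩
      · rwa [level, if_pos hht]
      · rw [level, if_pos hht]
        exact (not_le.1 hneg).le) hu huv hv
  refine key.trans (add_le_add (mul_le_mul_of_nonneg_right hσ hthr) ?_)
  -- The rounding error is `2 * 2 ^ r / 2 ^ (r / 2 + 1)` with integer division, of the order of the
  -- square root of the block length.
  rw [ht, mul_div_assoc', div_le_iff₀ (by positivity)]
  push_cast
  rw [← pow_add, ← pow_succ']
  exact pow_le_pow_right₀ one_le_two (by lia)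

/-! ### Assembling an initial segment from dyadic blocks -/

theorem threshold_zero_eq (δ : ℝ) (b n : ℕ) : threshold δ b n n 0 0 = phi δ b (2 ^ n) := by
  rw [← threshold_G]
  simp

theorem threshold_block_eq (δ : ℝ) (b : ℕ) {n l : ℕ} (hl : 1 ≤ l) (hln : l ≤ n) :
    threshold δ b n (l - 1) (n - l) 0
      = ((2 : ℝ) ^ (-(1 : ℝ) / 6)) ^ (n - l + 3) * phi δ b (2 ^ n) := by
  rw [← threshold_H δ b hl hln]
  simp only [Nat.cast_zero, neg_zero, zero_div, Real.rpow_zero, one_mul]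
  congr 1
  rw [← Real.rpow_mul_natCast zero_le_two]
  congr 1
  push_cast [Nat.cast_sub hln]
  ring

theorem notMem_GUnion_HUnion_of_notMem_exceptional {δ : ℝ} {b n₀ n : ℕ} {x : ℝ}
    (hx : x ∉ exceptional δ b n₀) (hn : n₀ ≤ n) :
    x ∉ GUnion δ b n ∧ x ∉ HUnion δ b n := by
  simp only [exceptional, mem_iUnion, not_exists, mem_union, not_or] at hx
  exact hx n hn

theorem notMem_blockSet_of_notMem_HUnion {δ : ℝ} {b n l m : ℕ} {x : ℝ} (hx : x ∉ HUnion δ b n)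
    (hl : 1 ≤ l) (hnl : n ≤ 2 * l) (hln : l ≤ n) (hm : 1 ≤ m) (hm' : m ≤ 2 ^ (n - l)) :
    x ∉ blockSet δ b n (l - 1) (n - l) (2 ^ n + m * 2 ^ l) := by
  rintro ⟨h, a, hh, hh', ha, hx', hF⟩
  refine hx ⟨l, m, h, a, hl, ?_, hln, hm, hm', hh, hh', ha, hx', ?_⟩
  · rw [div_le_iff₀ two_pos, mul_comm]; exact_mod_cast hnl
  · rw [threshold_H δ b hl hln]; exact hF

theorem phi_nonneg {δ : ℝ} (hδ : 0 < δ) {b : ℕ} (hb : 2 ≤ b) (N : ℕ) : 0 ≤ phi δ b N := by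
  have h2 := one_le_two_mul_Ctilde hb
  have h3 : 0 ≤ Ctilde b := by linarith
  unfold phi
  positivity

theorem phi_mono {δ : ℝ} (hδ : 0 < δ) {b : ℕ} (hb : 2 ≤ b) {M N : ℕ} (hM : 3 ≤ M) (hMN : M ≤ N) :
    phi δ b M ≤ phi δ b N := by
  have h2 := one_le_two_mul_Ctilde hb
  have h3 : 0 ≤ Ctilde b := by linarith
  have hM' : (3 : ℝ) ≤ M := by exact_mod_cast hM
  have hMN' : (M : ℝ) ≤ N := by exact_mod_cast hMN
  have hlog1 : 1 ≤ Real.log M := by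
    rw [Real.le_log_iff_exp_le (by linarith)]
    linarith [Real.exp_one_lt_d9]
  have hlog : Real.log M ≤ Real.log N := Real.log_le_log (by linarith) hMN'
  have hll : Real.log (Real.log M) ≤ Real.log (Real.log N) := Real.log_le_log (by linarith) hlog
  have hll0 : 0 ≤ Real.log (Real.log M) := Real.log_nonneg hlog1
  unfold phi
  gcongr

/-- The deviation over a block of length `2 ^ (l - 1)` starting at `2 ^ n + m 2 ^ l`, with `m = 0`
allowed. -/
theorem F_block_le {δ : ℝ} (hδ : 0 < δ) {b n₀ n l m : ℕ} (hb : 2 ≤ b) {x : ℝ}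
    (hx : x ∈ Ioo (0 : ℝ) 1) (hxE : x ∉ exceptional δ b n₀) (hn₀ : n₀ < n) (hn6 : 6 ≤ n)
    (hnl : n ≤ 2 * l) (hln : l + 1 ≤ n) (hm : m + 1 ≤ 2 ^ (n - l)) {u v : ℝ} (hu : 0 ≤ u)
    (huv : u ≤ v) (hv : v ≤ 1) :
    F (2 ^ n + m * 2 ^ l) (2 ^ (l - 1)) u v (orbit b x)
      ≤ 12.42 * (((2 : ℝ) ^ (-(1 : ℝ) / 6)) ^ (n - l + 3) * phi δ b (2 ^ n)) + 2 ^ (l / 2) := by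
  obtain ⟨hκ0, hκ1, -⟩ := block_constant_le rfl
  have hpos : ∀ n l : ℕ, 1 ≤ l → l ≤ n → 0 ≤ threshold δ b n (l - 1) (n - l) 0 := by
    intro n l h1 h2
    rw [threshold_block_eq δ b h1 h2]
    exact mul_nonneg (by positivity) (phi_nonneg hδ hb _)
  have hl : (l - 1 + 1) / 2 = l / 2 := by rw [Nat.sub_add_cancel (by lia)]
  rcases Nat.eq_zero_or_pos m with rfl | hm0
  -- The block starting at `2 ^ n` is not covered by `HUnion` at `n`, where `m ≥ 1`, but it is the
  -- block `m = 2 ^ (n - 1 - l)` of `HUnion` at `n - 1`. This is why `n₀ < n` and `l + 1 ≤ n` are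
  -- needed.
  · have hxH := (notMem_GUnion_HUnion_of_notMem_exceptional hxE (by lia : n₀ ≤ n - 1)).2
    have hB := notMem_blockSet_of_notMem_HUnion hxH (l := l) (m := 2 ^ (n - 1 - l)) (by lia)
      (by lia) (by lia) Nat.one_le_two_pow le_rfl
    have hstart : 2 ^ (n - 1) + 2 ^ (n - 1 - l) * 2 ^ l = 2 ^ n + 0 * 2 ^ l := by
      rw [← pow_add, Nat.sub_add_cancel (by lia), ← two_mul, ← pow_succ',
        Nat.sub_add_cancel (by lia)]
      simp
    rw [hstart] at hB
    refine (F_le_of_notMem_blockSet (by lia) hx hB (hpos _ _ (by lia) (by lia)) hu huv hv).trans ?_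
    rw [hl, threshold_block_eq δ b (by lia) (by lia)]
    -- Going down to `n - 1` loses one factor `κ` in the threshold; `phi` decreases by at least `2 ^
    -- (-1/2)`, which is more than enough to restore it.
    have h2n : phi δ b (2 ^ (n - 1)) ≤ (2 : ℝ) ^ (-(1 : ℝ) / 6) * phi δ b (2 ^ n) := by
      have e1 : (2 : ℝ) ^ (-(1 : ℝ) / 6) * phi δ b (2 ^ n)
          = 2 ^ ((1 : ℝ) / 3) * ((2 : ℝ) ^ (-(1 : ℝ) / 2) * phi δ b (2 ^ n)) := by
        rw [← mul_assoc, ← Real.rpow_add two_pos]; norm_num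
      have e2 : phi δ b (2 ^ (n - 1)) ≤ (2 : ℝ) ^ (-(1 : ℝ) / 2) * phi δ b (2 ^ n) := by
        have hb2 := one_le_two_mul_Ctilde hb
        have hb3 : 0 ≤ Ctilde b := by linarith
        have h8 : (3 : ℝ) ≤ 2 ^ (n - 1) :=
          le_trans (by norm_num) (pow_le_pow_right₀ one_le_two (by lia : 2 ≤ n - 1))
        have hlog1 : 1 ≤ Real.log (2 ^ (n - 1)) := by
          rw [Real.le_log_iff_exp_le (by positivity)]
          linarith [Real.exp_one_lt_d9]
        have hlog : Real.log (2 ^ (n - 1)) ≤ Real.log (2 ^ n) :=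
          Real.log_le_log (by positivity) (pow_le_pow_right₀ one_le_two (by lia))
        have hll := Real.log_le_log (by linarith) hlog
        have e3 : (2 : ℝ) ^ (-(1 : ℝ) / 2) * Real.sqrt (2 ^ n * Real.log (Real.log (2 ^ n)))
            = Real.sqrt (2 ^ (n - 1) * Real.log (Real.log (2 ^ n))) := by
          have : (2 : ℝ) ^ n = 2 ^ (n - 1) * 2 := by
            rw [← pow_succ, Nat.sub_add_cancel (by lia)]
          have e4 : (2 : ℝ) ^ (-(1 : ℝ) / 2) = (Real.sqrt 2)⁻¹ := by
            rw [neg_div, Real.rpow_neg zero_le_two, Real.sqrt_eq_rpow]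
          rw [e4, this, mul_right_comm, Real.sqrt_mul' _ zero_le_two]
          field_simp
        unfold phi
        push_cast
        calc _ ≤ 2 * (1 + 2 * δ) * Ctilde b
              * Real.sqrt (2 ^ (n - 1) * Real.log (Real.log (2 ^ n))) := by gcongr
          _ = _ := by rw [← e3]; ring
      rw [e1]
      refine e2.trans (le_mul_of_one_le_left ?_ (Real.one_le_rpow one_le_two (by norm_num)))
      exact mul_nonneg (by positivity) (phi_nonneg hδ hb _)
    have e5 : n - l + 3 = n - 1 - l + 3 + 1 := by lia
    rw [e5, pow_succ _ (n - 1 - l + 3), mul_assoc]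
    gcongr
  · have hxH := (notMem_GUnion_HUnion_of_notMem_exceptional hxE (by lia : n₀ ≤ n)).2
    have hB := notMem_blockSet_of_notMem_HUnion hxH (l := l) (m := m) (by lia) hnl (by lia) hm0
      (by lia)
    have := F_le_of_notMem_blockSet (by lia) hx hB (hpos _ _ (by lia) (by lia)) hu huv hv
    rwa [hl, threshold_block_eq δ b (by lia) (by lia)] at this

theorem two_pow_half_le (l : ℕ) : (2 : ℝ) ^ (l / 2) ≤ Real.sqrt 2 ^ l := by
  have h1 : (2 : ℝ) ^ (l / 2) = Real.sqrt 2 ^ (2 * (l / 2)) := by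
    rw [pow_mul, Real.sq_sqrt zero_le_two]
  rw [h1]
  exact pow_le_pow_right₀ (Real.one_le_sqrt.2 one_le_two) (Nat.mul_div_le l 2)

/-- The deviation over an initial piece of a dyadic block, by binary expansion of its length. -/
theorem F_initial_le {δ : ℝ} (hδ : 0 < δ) {b n₀ n : ℕ} (hb : 2 ≤ b) {x : ℝ}
    (hx : x ∈ Ioo (0 : ℝ) 1) (hxE : x ∉ exceptional δ b n₀) (hn₀ : n₀ < n) (hn6 : 6 ≤ n)
    {u v : ℝ} (hu : 0 ≤ u) (huv : u ≤ v) (hv : v ≤ 1) {l : ℕ} (hl : (n - 1) / 2 ≤ l) :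
    ∀ m q : ℕ, l + 1 ≤ n → m + 1 ≤ 2 ^ (n - l) → q < 2 ^ l →
      F (2 ^ n + m * 2 ^ l) q u v (orbit b x)
        ≤ 12.42 * (((2 : ℝ) ^ (-(1 : ℝ) / 6)) ^ (n - l + 3) / (1 - (2 : ℝ) ^ (-(1 : ℝ) / 6))
            * phi δ b (2 ^ n)) + 2 ^ ((n - 1) / 2) + 4 * Real.sqrt 2 ^ l := by
  obtain ⟨hκ0, hκ1, -⟩ := block_constant_le rfl
  set κ := (2 : ℝ) ^ (-(1 : ℝ) / 6)
  have hφ := phi_nonneg hδ hb (2 ^ n)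
  have h1κ : 0 < 1 - κ := by linarith
  have hs : 1.4 ≤ Real.sqrt 2 := Real.le_sqrt_of_sq_le (by norm_num)
  induction l, hl using Nat.le_induction with
  | base =>
    intro m q hln hm hq
    -- Below the scale `n / 2` the trivial bound by the number of terms is already of order the
    -- square root of `2 ^ n`.
    have h1 : F (2 ^ n + m * 2 ^ ((n - 1) / 2)) q u v (orbit b x) ≤ 2 ^ ((n - 1) / 2) :=
      (F_le hu hv huv _ _ _).trans (by exact_mod_cast hq.le)
    have h2 : 0 ≤ 12.42 * (κ ^ (n - (n - 1) / 2 + 3) / (1 - κ) * phi δ b (2 ^ n)) := by positivity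
    have h3 : 0 ≤ 4 * Real.sqrt 2 ^ ((n - 1) / 2) := by positivity
    linarith
  | succ l hl ih =>
    intro m q hln hm hq
    have hpow : 2 ^ (n - l) = 2 * 2 ^ (n - (l + 1)) := by
      rw [← pow_succ']; congr 1; lia
    have hκ : κ ^ (n - l + 3) = κ * κ ^ (n - (l + 1) + 3) := by
      rw [← pow_succ']; congr 1; lia
    have hsum : κ ^ (n - l + 3) / (1 - κ) + κ ^ (n - (l + 1) + 3)
        = κ ^ (n - (l + 1) + 3) / (1 - κ) := by
      rw [hκ]; field_simp; ring
    have hsq : Real.sqrt 2 ^ (l + 1) = Real.sqrt 2 * Real.sqrt 2 ^ l := pow_succ' _ _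
    have hsl : 0 < Real.sqrt 2 ^ l := by positivity
    have hB := F_block_le hδ hb hx hxE hn₀ hn6 (l := l + 1) (m := m) (by lia) hln hm hu huv hv
    have hhalf := two_pow_half_le (l + 1)
    have hκφ : 0 ≤ κ ^ (n - (l + 1) + 3) * phi δ b (2 ^ n) := by positivity
    have hstart : 2 ^ n + m * 2 ^ (l + 1) = 2 ^ n + (2 * m) * 2 ^ l := by ring
    have hsum' := congrArg (· * phi δ b (2 ^ n)) hsum
    simp only [add_mul] at hsum'
    -- The next binary digit of `q`: if it is zero, only the start is rewritten with `2 * m`; if it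
    -- is one, a block of length `2 ^ l` is split off and the rest starts at `2 * m + 1`. The term
    -- `4 * √2 ^ l` reproduces itself because `4 + √2 ≤ 4 * √2`.
    rcases lt_or_ge q (2 ^ l) with hq' | hq'
    · have := ih (2 * m) q (by lia) (by lia) hq'
      rw [hstart]
      nlinarith
    · obtain ⟨q', rfl⟩ := Nat.exists_eq_add_of_le hq'
      have h1 := ih (2 * m + 1) q' (by lia) (by lia) (by rw [pow_succ] at hq; lia)
      have h2 := F_add_le (2 ^ n + m * 2 ^ (l + 1)) (2 ^ l) q' u v (orbit b x)
      have hstart' : 2 ^ n + m * 2 ^ (l + 1) + 2 ^ l = 2 ^ n + (2 * m + 1) * 2 ^ l := by ring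
      rw [hstart'] at h2
      rw [Nat.add_sub_cancel] at hB
      change _ ≤ 12.42 * (κ ^ (n - (l + 1) + 3) * phi δ b (2 ^ n)) + 2 ^ ((l + 1) / 2) at hB
      nlinarith

/-- The deviation over the first `N` terms. -/
theorem F_zero_le {δ : ℝ} (hδ : 0 < δ) {b n₀ n N : ℕ} (hb : 2 ≤ b) {x : ℝ}
    (hx : x ∈ Ioo (0 : ℝ) 1) (hxE : x ∉ exceptional δ b n₀) (hn₀ : n₀ < n) (hn6 : 6 ≤ n)
    (hnN : 2 ^ n ≤ N) (hNn : N < 2 ^ (n + 1)) {u v : ℝ} (hu : 0 ≤ u) (huv : u ≤ v) (hv : v ≤ 1) :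
    F 0 N u v (orbit b x) ≤ 160 * phi δ b (2 ^ n) + 20 * Real.sqrt 2 ^ n := by
  obtain ⟨hκ0, hκ1, hκ⟩ := block_constant_le rfl
  have hφ := phi_nonneg hδ hb (2 ^ n)
  have hs1 : 1 ≤ Real.sqrt 2 := Real.one_le_sqrt.2 one_le_two
  have hs2 : Real.sqrt 2 ≤ 1.5 := Real.sqrt_le_iff.2 ⟨by norm_num, by norm_num⟩
  have hsn : 1 ≤ Real.sqrt 2 ^ n := one_le_pow₀ hs1
  have hG : F 0 (2 ^ n) u v (orbit b x) ≤ 12.42 * phi δ b (2 ^ n) + 1.5 * Real.sqrt 2 ^ n := by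
    have hxG := (notMem_GUnion_HUnion_of_notMem_exceptional hxE hn₀.le).1
    rw [GUnion_eq] at hxG
    have := F_le_of_notMem_blockSet (by lia) hx hxG (by rwa [threshold_zero_eq]) hu huv hv
    rw [threshold_zero_eq] at this
    have h2 := two_pow_half_le (n + 1)
    rw [pow_succ' (Real.sqrt 2)] at h2
    nlinarith
  have hI : ∀ m q : ℕ, m + 1 ≤ 2 → q < 2 ^ (n - 1) →
      F (2 ^ n + m * 2 ^ (n - 1)) q u v (orbit b x)
        ≤ 72 * phi δ b (2 ^ n) + 5 * Real.sqrt 2 ^ n := by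
    intro m q hm hq
    have := F_initial_le hδ hb hx hxE hn₀ hn6 hu huv hv (l := n - 1) (by lia) m q (by lia)
      (by rw [show n - (n - 1) = 1 by lia]; simpa using hm) hq
    rw [show n - (n - 1) + 3 = 4 by lia] at this
    have h1 := mul_le_mul_of_nonneg_right hκ hφ
    have h2 : (2 : ℝ) ^ ((n - 1) / 2) ≤ Real.sqrt 2 ^ n :=
      (two_pow_half_le _).trans (pow_le_pow_right₀ hs1 (by lia))
    have h3 : Real.sqrt 2 ^ (n - 1) ≤ Real.sqrt 2 ^ n := pow_le_pow_right₀ hs1 (by lia)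
    linarith
  have hlow : ∀ q : ℕ, q < 2 ^ (n - 1) →
      F 0 (2 ^ n + q) u v (orbit b x) ≤ 85 * phi δ b (2 ^ n) + 7 * Real.sqrt 2 ^ n := by
    intro q hq
    have h1 := F_add_le 0 (2 ^ n) q u v (orbit b x)
    have h2 := hI 0 q (by norm_num) hq
    rw [zero_mul, add_zero] at h2
    rw [zero_add] at h1
    linarith
  obtain ⟨q, rfl⟩ := Nat.exists_eq_add_of_le hnN
  have hn : 2 ^ n = 2 * 2 ^ (n - 1) := by rw [← pow_succ']; congr 1; lia
  have hp : 1 ≤ 2 ^ (n - 1) := Nat.one_le_two_pow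
  rcases lt_or_ge q (2 ^ (n - 1)) with hq | hq
  · have := hlow q hq
    linarith
  · obtain ⟨q', rfl⟩ := Nat.exists_eq_add_of_le hq
    -- The block of length `2 ^ (n - 1)` starting at `2 ^ n` would need `l = n`, which `HUnion` at
    -- `n - 1` does not reach. It is taken as a piece shorter by one term, plus a single term with
    -- deviation at most `1`.
    have h1 := hlow (2 ^ (n - 1) - 1) (by lia)
    have h2 := hI 1 q' le_rfl (by rw [pow_succ] at hNn; lia)
    rw [one_mul] at h2
    have h3 := F_add_le 0 (2 ^ n + 2 ^ (n - 1)) q' u v (orbit b x)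
    have h4 := F_add_le 0 (2 ^ n + (2 ^ (n - 1) - 1)) 1 u v (orbit b x)
    have h5 := F_le hu hv huv (0 + (2 ^ n + (2 ^ (n - 1) - 1))) 1 (orbit b x)
    rw [show 2 ^ n + (2 ^ (n - 1) - 1) + 1 = 2 ^ n + 2 ^ (n - 1) by lia] at h4
    rw [zero_add, add_assoc] at h3
    push_cast at h5
    linarith

/-! ### The discrepancy and the limsup -/

theorem discrepancy_le {δ : ℝ} (hδ : 0 < δ) {b n₀ N : ℕ} (hb : 2 ≤ b) {x : ℝ}
    (hx : x ∈ Ioo (0 : ℝ) 1) (hxE : x ∉ exceptional δ b n₀) (hN : 2 ^ (n₀ + 6) ≤ N) :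
    discrepancy N (orbit b x) ≤ (160 * phi δ b N + 20 * Real.sqrt N) / N := by
  have hN0 : 0 < N := lt_of_lt_of_le (by positivity) hN
  have hN' : (0 : ℝ) < N := by exact_mod_cast hN0
  set n := Nat.log 2 N
  have hn : n₀ + 6 ≤ n := Nat.le_log_of_pow_le one_lt_two hN
  have hnN : 2 ^ n ≤ N := Nat.pow_log_le_self 2 hN0.ne'
  have hNn : N < 2 ^ (n + 1) := Nat.lt_pow_succ_log_self one_lt_two N
  refine csSup_le ⟨_, 0, 1, le_rfl, one_pos, le_rfl, rfl⟩ ?_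
  rintro d ⟨u, v, hu, huv, hv, rfl⟩
  have h1 := F_zero_le hδ hb hx hxE (by lia) (by lia) hnN hNn hu huv.le hv
  have h2 : phi δ b (2 ^ n) ≤ phi δ b N := phi_mono hδ hb
    (le_trans (by norm_num) (Nat.pow_le_pow_right two_pos (by lia : 2 ≤ n))) hnN
  have h3 : Real.sqrt 2 ^ n ≤ Real.sqrt N := by
    refine Real.le_sqrt_of_sq_le ?_
    rw [← pow_mul, mul_comm, pow_mul, Real.sq_sqrt zero_le_two]
    exact_mod_cast hnN
  have e : |(visits 0 N u v (orbit b x) : ℝ) / N - (v - u)| = F 0 N u v (orbit b x) / N := by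
    rw [F, ← abs_of_pos hN', ← abs_div, abs_of_pos hN']
    congr 1
    field_simp
  rw [e]
  gcongr
  linarith

theorem limsup_discrepancy_lt {δ : ℝ} (hδ : 0 < δ) {b n₀ : ℕ} (hb : 2 ≤ b) {x : ℝ}
    (hx : x ∈ Ioo (0 : ℝ) 1) (hxE : x ∉ exceptional δ b n₀) :
    limsup (fun N : ℕ => ((discrepancy N (orbit b x) * Real.sqrt (N : ℝ) /
      Real.sqrt (Real.log (Real.log (N : ℝ))) : ℝ) : EReal)) atTop
      < (((1 + 4 * δ) * philippConst b : ℝ) : EReal) := by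
  have hC1 := one_le_two_mul_Ctilde hb
  have hC : philippConst b = 332 * Ctilde b := by rw [philippConst, Ctilde]; ring
  have hev : ∀ᶠ N : ℕ in atTop, ((discrepancy N (orbit b x) * Real.sqrt (N : ℝ) /
      Real.sqrt (Real.log (Real.log (N : ℝ))) : ℝ) : EReal)
        ≤ ((332 * ((1 + 2 * δ) * Ctilde b) : ℝ) : EReal) := by
    -- Once `log log N ≥ 16`, so that `S ≥ 4`, the error `20` is at most `12 (1 + 2δ) * Ctilde b *
    -- S`, because `Ctilde b ≥ 1 / 2`. Thus `320` becomes `332`, and `332 * Ctilde b` is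
    -- `philippConst b`.
    have hll : Tendsto (fun N : ℕ => Real.log (Real.log (N : ℝ))) atTop atTop :=
      Real.tendsto_log_atTop.comp (Real.tendsto_log_atTop.comp tendsto_natCast_atTop_atTop)
    filter_upwards [hll.eventually_ge_atTop 16, eventually_ge_atTop (2 ^ (n₀ + 6))] with N h16 hN
    rw [EReal.coe_le_coe_iff]
    have hN0 : 0 < N := lt_of_lt_of_le (by positivity) hN
    have hN' : (0 : ℝ) < N := by exact_mod_cast hN0
    have hs : 4 ≤ Real.sqrt (Real.log (Real.log (N : ℝ))) :=
      Real.le_sqrt_of_sq_le (by norm_num; exact h16)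
    have hd := discrepancy_le hδ hb hx hxE hN
    set S := Real.sqrt (Real.log (Real.log (N : ℝ))) with hS
    have hφ : phi δ b N = 2 * (1 + 2 * δ) * Ctilde b * (Real.sqrt N * S) := by
      rw [phi, Real.sqrt_mul hN'.le]
    have hsN : 0 < Real.sqrt N := Real.sqrt_pos.2 hN'
    rw [div_le_iff₀ (by linarith)]
    calc discrepancy N (orbit b x) * Real.sqrt N
        ≤ (160 * phi δ b N + 20 * Real.sqrt N) / N * Real.sqrt N := by gcongr
      _ = 320 * ((1 + 2 * δ) * Ctilde b) * S + 20 := by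
          rw [hφ]
          nth_rewrite 3 [← Real.mul_self_sqrt hN'.le]
          field_simp
          ring
      _ ≤ _ := by nlinarith [mul_pos hδ (by linarith : 0 < Ctilde b)]
  refine lt_of_le_of_lt (limsup_le_of_le (h := hev)) ?_
  rw [EReal.coe_lt_coe_iff, hC]
  nlinarith [mul_pos hδ (by linarith : 0 < Ctilde b)]

end PhilippLIL

theorem mainTheorem2 (η δ : ℝ) (hη : 0 < η) (hδ : 0 < δ) :
    (∀ n : ℕ, Real.exp (6 / (δ * Real.log 2)) < (n : ℝ) → ∀ b : ℕ, 2 ≤ b →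
      MeasureTheory.volume (PhilippLIL.GUnion δ b n) ≤
          ENNReal.ofReal ((n : ℝ) ^ (-1 - 4 * δ)) ∧
      MeasureTheory.volume (PhilippLIL.HUnion δ b n) ≤
          ENNReal.ofReal (2 * (n : ℝ) ^ (-1 - 3 * δ))) ∧
    ∃ n₀ : ℕ, ∀ b : ℕ, 2 ≤ b →
      MeasureTheory.volume (PhilippLIL.exceptional δ b n₀) < ENNReal.ofReal η ∧
      ∀ x ∈ Set.Ioo (0 : ℝ) 1, x ∉ PhilippLIL.exceptional δ b n₀ →
        Filter.limsup (fun N : ℕ =>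
            ((PhilippLIL.discrepancy N (PhilippLIL.orbit b x) * Real.sqrt (N : ℝ) /
              Real.sqrt (Real.log (Real.log (N : ℝ))) : ℝ) : EReal)) Filter.atTop <
          (((1 + 4 * δ) * PhilippLIL.philippConst b : ℝ) : EReal) := by
  refine ⟨fun n hn b hb => ⟨PhilippLIL.volume_GUnion_le hδ hn hb,
    PhilippLIL.volume_HUnion_le hδ hn hb⟩, ?_⟩
  obtain ⟨n₀, hn₀⟩ := PhilippLIL.exists_volume_exceptional_lt hη hδ
  exact ⟨n₀, fun b hb => ⟨hn₀ b hb, fun x hx hxE => PhilippLIL.limsup_discrepancy_lt hδ hb hx hxE⟩⟩
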